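/- Fix $q\in(0,1)$. Let $Pol(Mat_2)_q$ be the unital complex $*$-algebra with generators $z_a^\alpha$ ($a,\alpha\in\{1,2\}$) and relations $$z_1^1z_2^1=qz_2^1z_1^1,\quad z_2^1z_1^2=z_1^2z_2^1,\quad z_1^1z_1^2=qz_1^2z_1^1,\quad z_2^1z_2^2=qz_2^2z_2^1,\quad z_1^2z_2^2=qz_2^2z_1^2,$$ $$z_1^1z_2^2-z_2^2z_1^1=(q-q^{-1})z_1^2z_2^1,$$ $$(z_1^1)^*z_1^1=q^2z_1^1(z_1^1)^*-(1-q^2)\big(z_2^1(z_2^1)^*+z_1^2(z_1^2)^*\big)+q^{-2}(1-q^2)^2z_2^2(z_2^2)^*+1-q^2,$$ $$(z_2^1)^*z_2^1=q^2z_2^1(z_2^1)^*-(1-q^2)z_2^2(z_2^2)^*+1-q^2,\quad (z_1^2)^*z_1^2=q^2z_1^2(z_1^2)^*-(1-q^2)z_2^2(z_2^2)^*+1-q^2,$$ $$(z_2^2)^*z_2^2=q^2z_2^2(z_2^2)^*+1-q^2,$$ $$(z_1^1)^*z_2^1-qz_2^1(z_1^1)^*=(q-q^{-1})z_2^2(z_1^2)^*,\quad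 (z_1^1)^*z_1^2-qz_1^2(z_1^1)^*=(q-q^{-1})z_2^2(z_2^1)^*,$$ $$(z_2^2)^*z_2^1=qz_2^1(z_2^2)^*,\quad (z_2^2)^*z_1^2=qz_1^2(z_2^2)^*,\quad (z_1^1)^*z_2^2=z_2^2(z_1^1)^*,\quad (z_2^1)^*z_1^2=z_1^2(z_2^1)^*.$$ Let $J$ be the two-sided ideal of $Pol(Mat_2)_q$ generated by the elements $$\sum_{j=1}^2 q^{4-\alpha-\beta}z_j^\alpha(z_j^\beta)^*-\delta^{\alpha\beta},\qquad \alpha,\beta\in\{1,2\}$$ (a bounded $*$-representation of $Pol(Mat_2)_q$ vanishes on $J$ if and only if its extension to the universal enveloping $C^*$-algebra vanishes on the closed two-sided ideal generated by these elements). On $\ell^2(\mathbb Z_+)$ with standard basis $(e_n)_{n\ge0}$ let $Se_n=e_{n+1}$, $Ce_n=(1-q^{2n})^{1/2}e_n$, $d(q)e_n=q^ne_n$, and let $C^*(S)$ be the $C^*$-algebra generated by $S$. For $\varphi_1,\varphi_2\in\mathbb R$ let $\rho_{\varphi_1,\varphi_2}$ be the $*$-representation of $Pol(Mat_2)_q$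 on $\ell^2(\mathbb Z_+)$ with $$\rho_{\varphi_1,\varphi_2}(z_2^2)=CS,\quad \rho_{\varphi_1,\varphi_2}(z_2^1)=e^{i\varphi_1}d(q),\quad \rho_{\varphi_1,\varphi_2}(z_1^2)=e^{i\varphi_2}d(q),\quad \rho_{\varphi_1,\varphi_2}(z_1^1)=-e^{i(\varphi_1+\varphi_2)}q^{-1}S^*C,$$ and let $\gamma_{\varphi_1,\varphi_2}$ be the one-dimensional $*$-representation with $$\gamma_{\varphi_1,\varphi_2}(z_2^2)=e^{i\varphi_1},\quad \gamma_{\varphi_1,\varphi_2}(z_2^1)=\gamma_{\varphi_1,\varphi_2}(z_1^2)=0,\quad \gamma_{\varphi_1,\varphi_2}(z_1^1)=e^{i\varphi_2}q^{-1}.$$ Then: (1) If $\pi$ is a unital $*$-representation of $Pol(Mat_2)_q$ by bounded operators on a complex Hilbert space and $\pi$ annihilates $J$, then for every $a\in Pol(Mat_2)_q$ $$\|\pi(a)\|\le\sup_{\psi_1,\psi_2\in[0,2\pi)}\|\rho_{\psi_1,\psi_2}(a)\|<\infty.$$ (2) For all $\varphi_1,\varphi_2\in\mathbb R$ there is a unital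 $*$-homomorphism $\Theta\colon C^*(S)\to\mathbb C$ with $\Theta(S)=e^{i\varphi_1}$ such that, for every $a\in Pol(Mat_2)_q$, one has $\rho_{\varphi_1,\pi+\varphi_2}(a)\in C^*(S)$ and $\Theta(\rho_{\varphi_1,\pi+\varphi_2}(a))=\gamma_{\varphi_1,\varphi_2}(a)$ (here $\pi$ is the number). -/

import Mathlib

open scoped ComplexConjugate

namespace QuantumBall

noncomputable section

/-! Index convention: `z a α` stands for the generator with lower index `a + 1` and upper
index `α + 1`, so `z 0 0`, `z 1 0`, `z 0 1`, `z 1 1` are $z_1^1, z_2^1, z_1^2, z_2^2$. -/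

/-- The defining relations of the `*`-algebra $Pol(Mat_2)_q$, for elements `z a α` of a complex
algebra and elements `y a α` in the role of the adjoints of the `z a α`. -/
inductive MatRel (q : ℝ) {A : Type*} [Ring A] [Algebra ℂ A] (z y : Fin 2 → Fin 2 → A) :
    A → A → Prop
  | h1 : MatRel q z y (z 0 0 * z 1 0) ((q : ℂ) • (z 1 0 * z 0 0))
  | h2 : MatRel q z y (z 1 0 * z 0 1) (z 0 1 * z 1 0)
  | h3 : MatRel q z y (z 0 0 * z 0 1) ((q : ℂ) • (z 0 1 * z 0 0))
  | h4 : MatRel q z y (z 1 0 * z 1 1) ((q : ℂ) • (z 1 1 * z 1 0))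
  | h5 : MatRel q z y (z 0 0 * z 1 1 - z 1 1 * z 0 0)
      (((q : ℂ) - (q : ℂ)⁻¹) • (z 0 1 * z 1 0))
  | h6 : MatRel q z y (z 0 1 * z 1 1) ((q : ℂ) • (z 1 1 * z 0 1))
  | m1 : MatRel q z y (y 0 0 * z 0 0)
      ((q : ℂ) ^ 2 • (z 0 0 * y 0 0) - (1 - (q : ℂ) ^ 2) • (z 1 0 * y 1 0 + z 0 1 * y 0 1)
        + (((q : ℂ) ^ 2)⁻¹ * (1 - (q : ℂ) ^ 2) ^ 2) • (z 1 1 * y 1 1)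
        + (1 - (q : ℂ) ^ 2) • (1 : A))
  | m2 : MatRel q z y (y 1 0 * z 1 0)
      ((q : ℂ) ^ 2 • (z 1 0 * y 1 0) - (1 - (q : ℂ) ^ 2) • (z 1 1 * y 1 1)
        + (1 - (q : ℂ) ^ 2) • (1 : A))
  | m3 : MatRel q z y (y 0 1 * z 0 1)
      ((q : ℂ) ^ 2 • (z 0 1 * y 0 1) - (1 - (q : ℂ) ^ 2) • (z 1 1 * y 1 1)
        + (1 - (q : ℂ) ^ 2) • (1 : A))
  | m4 : MatRel q z y (y 1 1 * z 1 1)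
      ((q : ℂ) ^ 2 • (z 1 1 * y 1 1) + (1 - (q : ℂ) ^ 2) • (1 : A))
  | c1 : MatRel q z y (y 0 0 * z 1 0 - (q : ℂ) • (z 1 0 * y 0 0))
      (((q : ℂ) - (q : ℂ)⁻¹) • (z 1 1 * y 0 1))
  | c2 : MatRel q z y (y 1 1 * z 1 0) ((q : ℂ) • (z 1 0 * y 1 1))
  | c3 : MatRel q z y (y 0 0 * z 0 1 - (q : ℂ) • (z 0 1 * y 0 0))
      (((q : ℂ) - (q : ℂ)⁻¹) • (z 1 1 * y 1 0))
  | c4 : MatRel q z y (y 1 1 * z 0 1) ((q : ℂ) • (z 0 1 * y 1 1))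
  | c5 : MatRel q z y (y 0 0 * z 1 1) (z 1 1 * y 0 0)
  | c6 : MatRel q z y (y 1 0 * z 0 1) (z 0 1 * y 1 0)

theorem MatRel.map {q : ℝ} {A B : Type*} [Ring A] [Algebra ℂ A] [Ring B] [Algebra ℂ B]
    {z y : Fin 2 → Fin 2 → A} (f : A →ₐ[ℂ] B) {a b : A} (h : MatRel q z y a b) :
    MatRel q (fun i j => f (z i j)) (fun i j => f (y i j)) (f a) (f b) := by
  cases h <;> simp only [map_mul, map_add, map_sub, map_smul, map_one] <;> constructor

/-- The free algebra on the symbols $z_a^α$ (`Sum.inl`) and $(z_a^α)^*$ (`Sum.inr`). -/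
abbrev FreeAlg : Type := FreeAlgebra ℂ ((Fin 2 × Fin 2) ⊕ (Fin 2 × Fin 2))

/-- The symbols $z_a^α$. -/
def freeZ (a α : Fin 2) : FreeAlg := FreeAlgebra.ι ℂ (Sum.inl (a, α))

/-- The symbols $(z_a^α)^*$. -/
def freeZstar (a α : Fin 2) : FreeAlg := FreeAlgebra.ι ℂ (Sum.inr (a, α))

/-- For a map `g` from the symbols to a star algebra, the ring homomorphism from the free algebra
to the opposite algebra that conjugates scalars and sends the symbol `s` to `g s`. -/
def conjLift {B : Type*} [Ring B] [Algebra ℂ B]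
    (g : (Fin 2 × Fin 2) ⊕ (Fin 2 × Fin 2) → B) : FreeAlg →+* Bᵐᵒᵖ :=
  letI : Algebra ℂ Bᵐᵒᵖ := Algebra.compHom Bᵐᵒᵖ (starRingEnd ℂ)
  (FreeAlgebra.lift ℂ (fun s => MulOpposite.op (g s)) : FreeAlg →ₐ[ℂ] Bᵐᵒᵖ).toRingHom

theorem conjLift_ι {B : Type*} [Ring B] [Algebra ℂ B]
    (g : (Fin 2 × Fin 2) ⊕ (Fin 2 × Fin 2) → B) (s : (Fin 2 × Fin 2) ⊕ (Fin 2 × Fin 2)) :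
    conjLift g (FreeAlgebra.ι ℂ s) = MulOpposite.op (g s) := by
  let : Algebra ℂ Bᵐᵒᵖ := Algebra.compHom Bᵐᵒᵖ (starRingEnd ℂ)
  exact FreeAlgebra.lift_ι_apply _ _

theorem conjLift_algebraMap {B : Type*} [Ring B] [Algebra ℂ B]
    (g : (Fin 2 × Fin 2) ⊕ (Fin 2 × Fin 2) → B) (c : ℂ) :
    conjLift g (algebraMap ℂ FreeAlg c) = MulOpposite.op (algebraMap ℂ B (conj c)) := by
  let : Algebra ℂ Bᵐᵒᵖ := Algebra.compHom Bᵐᵒᵖ (starRingEnd ℂ)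
  exact (FreeAlgebra.lift ℂ (fun s => MulOpposite.op (g s)) : FreeAlg →ₐ[ℂ] Bᵐᵒᵖ).commutes c

/-- The involution of the free algebra: conjugate-linear, reverses products and exchanges
$z_a^α$ with $(z_a^α)^*$. -/
def freeAdj (x : FreeAlg) : FreeAlg :=
  (conjLift (fun s => FreeAlgebra.ι ℂ s.swap) x).unop

theorem freeAdj_ι (s : (Fin 2 × Fin 2) ⊕ (Fin 2 × Fin 2)) :
    freeAdj (FreeAlgebra.ι ℂ s) = FreeAlgebra.ι ℂ s.swap := by
  simp [freeAdj, conjLift_ι]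

theorem freeAdj_algebraMap (c : ℂ) :
    freeAdj (algebraMap ℂ FreeAlg c) = algebraMap ℂ FreeAlg (conj c) := by
  simp only [freeAdj, conjLift_algebraMap, MulOpposite.unop_op]

theorem freeAdj_add (x y : FreeAlg) : freeAdj (x + y) = freeAdj x + freeAdj y := by
  simp [freeAdj]

theorem freeAdj_mul (x y : FreeAlg) : freeAdj (x * y) = freeAdj y * freeAdj x := by
  simp [freeAdj]

theorem freeAdj_freeAdj (x : FreeAlg) : freeAdj (freeAdj x) = x := by
  induction x using FreeAlgebra.induction with
  | grade0 c => simp only [freeAdj_algebraMap, Complex.conj_conj]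
  | grade1 s => simp only [freeAdj_ι, Sum.swap_swap]
  | mul x y hx hy => simp only [freeAdj_mul, hx, hy]
  | add x y hx hy => simp only [freeAdj_add, hx, hy]

/-- The defining relations in the free algebra together with their adjoints. -/
inductive PolRel (q : ℝ) : FreeAlg → FreeAlg → Prop
  | base {a b : FreeAlg} (h : MatRel q freeZ freeZstar a b) : PolRel q a b
  | adj {a b : FreeAlg} (h : MatRel q freeZ freeZstar a b) : PolRel q (freeAdj a) (freeAdj b)

/-- The algebra $Pol(Mat_2)_q$. -/
def PolMat2 (q : ℝ) : Type := RingQuot (PolRel q)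

namespace PolMat2

variable (q : ℝ)

instance : Ring (PolMat2 q) := inferInstanceAs (Ring (RingQuot (PolRel q)))

instance : Algebra ℂ (PolMat2 q) := inferInstanceAs (Algebra ℂ (RingQuot (PolRel q)))

/-- The quotient map from the free algebra. -/
def mk : FreeAlg →ₐ[ℂ] PolMat2 q := RingQuot.mkAlgHom ℂ (PolRel q)

theorem mk_surjective : Function.Surjective (mk q) := RingQuot.mkAlgHom_surjective ℂ (PolRel q)

theorem mk_eq {a b : FreeAlg} (h : PolRel q a b) : mk q a = mk q b :=
  RingQuot.mkAlgHom_rel ℂ h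

/-- The generators $z_a^α$ of $Pol(Mat_2)_q$. -/
def z (a α : Fin 2) : PolMat2 q := mk q (freeZ a α)

theorem conjLift_mk (x : FreeAlg) :
    conjLift (fun s => mk q (FreeAlgebra.ι ℂ s.swap)) x = MulOpposite.op (mk q (freeAdj x)) := by
  induction x using FreeAlgebra.induction with
  | grade0 c => rw [conjLift_algebraMap, freeAdj_algebraMap, AlgHom.commutes]
  | grade1 s => rw [conjLift_ι, freeAdj_ι]
  | mul x y hx hy => rw [map_mul, hx, hy, freeAdj_mul, map_mul, MulOpposite.op_mul]
  | add x y hx hy => rw [map_add, hx, hy, freeAdj_add, map_add, MulOpposite.op_add]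

/-- The involution of $Pol(Mat_2)_q$ as a ring homomorphism to the opposite ring. -/
def starHom : PolMat2 q →+* (PolMat2 q)ᵐᵒᵖ :=
  RingQuot.lift ⟨conjLift (fun s => mk q (FreeAlgebra.ι ℂ s.swap)), by
    intro x y h
    rw [conjLift_mk, conjLift_mk]
    cases h with
    | base h => rw [mk_eq q (PolRel.adj h)]
    | adj h => rw [freeAdj_freeAdj, freeAdj_freeAdj, mk_eq q (PolRel.base h)]⟩

theorem starHom_mk (x : FreeAlg) : starHom q (mk q x) = MulOpposite.op (mk q (freeAdj x)) := by
  rw [← conjLift_mk]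
  have : mk q x = RingQuot.mkRingHom (PolRel q) x := by
    simp only [mk, RingQuot.mkAlgHom]
    rfl
  rw [this]
  exact RingQuot.lift_mkRingHom_apply _ _ _

instance : StarRing (PolMat2 q) where
  star x := (starHom q x).unop
  star_involutive x := by
    obtain ⟨x, rfl⟩ := mk_surjective q x
    simp only [starHom_mk, MulOpposite.unop_op, freeAdj_freeAdj]
  star_mul x y := by simp
  star_add x y := by simp

theorem star_mk (x : FreeAlg) : star (mk q x) = mk q (freeAdj x) := by
  change (starHom q (mk q x)).unop = _
  rw [starHom_mk, MulOpposite.unop_op]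

theorem star_algebraMap (c : ℂ) :
    star (algebraMap ℂ (PolMat2 q) c) = algebraMap ℂ (PolMat2 q) (conj c) := by
  rw [← (mk q).commutes, star_mk, freeAdj_algebraMap, (mk q).commutes]

instance : StarModule ℂ (PolMat2 q) where
  star_smul c x := by
    rw [Algebra.smul_def, star_mul, star_algebraMap, ← Algebra.commutes, ← Algebra.smul_def]
    rfl

theorem star_z (a α : Fin 2) : star (z q a α) = mk q (freeZstar a α) := by
  rw [z, star_mk, freeZ, freeAdj_ι]
  rfl

/-- The generators and their adjoints satisfy the defining relations. -/
theorem rel {a b : PolMat2 q} (h : MatRel q (z q) (fun i j => star (z q i j)) a b) : a = b := by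
  simp only [star_z] at h
  cases h <;> (
    simp only [z, ← map_mul, ← map_add, ← map_sub, ← map_smul, ← map_one (mk q)]
    exact mk_eq q (PolRel.base (by constructor)))

variable {q}
variable {B : Type*} [Ring B] [Algebra ℂ B] [StarRing B]

/-- The algebra homomorphism on the free algebra determined by the values on the $z_a^α$. -/
def preLift (Z : Fin 2 → Fin 2 → B) : FreeAlg →ₐ[ℂ] B :=
  FreeAlgebra.lift ℂ (Sum.elim (fun p => Z p.1 p.2) (fun p => star (Z p.1 p.2)))

theorem preLift_freeZ (Z : Fin 2 → Fin 2 → B) (a α : Fin 2) : preLift Z (freeZ a α) = Z a α := by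
  simp [preLift, freeZ]

theorem preLift_freeZstar (Z : Fin 2 → Fin 2 → B) (a α : Fin 2) :
    preLift Z (freeZstar a α) = star (Z a α) := by
  simp [preLift, freeZstar]

theorem preLift_freeAdj [StarModule ℂ B] (Z : Fin 2 → Fin 2 → B) (x : FreeAlg) :
    preLift Z (freeAdj x) = star (preLift Z x) := by
  induction x using FreeAlgebra.induction with
  | grade0 c => 
    rw [freeAdj_algebraMap, AlgHom.commutes, AlgHom.commutes]
    exact algebraMap_star_comm c
  | grade1 s => rw [freeAdj_ι]; rcases s with p | p <;> simp [preLift]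
  | mul x y hx hy => rw [freeAdj_mul, map_mul, map_mul, hx, hy, star_mul]
  | add x y hx hy => rw [freeAdj_add, map_add, map_add, hx, hy, star_add]

/-- The universal property: elements of a complex `*`-algebra that satisfy the relations together
with their adjoints define a unital `*`-homomorphism on $Pol(Mat_2)_q$. -/
def lift [StarModule ℂ B] (Z : Fin 2 → Fin 2 → B)
    (hZ : ∀ a b, MatRel q Z (fun i j => star (Z i j)) a b → a = b) : PolMat2 q →⋆ₐ[ℂ] B :=
  have key : ∀ a b, MatRel q freeZ freeZstar a b → preLift Z a = preLift Z b := by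
    intro a b h
    have h' := h.map (preLift Z)
    simp only [preLift_freeZ, preLift_freeZstar] at h'
    exact hZ _ _ h'
  have key2 : ∀ ⦃a b⦄, PolRel q a b → preLift Z a = preLift Z b := by
    intro a b h
    cases h with
    | base h => exact key _ _ h
    | adj h => rw [preLift_freeAdj, preLift_freeAdj, key _ _ h]
  let f : PolMat2 q →ₐ[ℂ] B := RingQuot.liftAlgHom ℂ ⟨preLift Z, key2⟩
  { f with
    map_star' := by
      intro x
      obtain ⟨x, rfl⟩ := mk_surjective q x
      have hf : ∀ x, f (mk q x) = preLift Z x := fun x =>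
        RingQuot.liftAlgHom_mkAlgHom_apply ℂ (preLift Z) key2 x
      change f (star (mk q x)) = star (f (mk q x))
      rw [star_mk, hf, hf, preLift_freeAdj] }

theorem lift_z [StarModule ℂ B] (Z : Fin 2 → Fin 2 → B)
    (hZ : ∀ a b, MatRel q Z (fun i j => star (Z i j)) a b → a = b) (a α : Fin 2) :
    lift Z hZ (z q a α) = Z a α := by
  rw [← preLift_freeZ Z a α]
  exact RingQuot.liftAlgHom_mkAlgHom_apply ℂ (preLift Z) _ _

/-- The two-sided ideal generated by
$\sum_j q^{4-α-β} z_j^α (z_j^β)^* - δ^{αβ}$, $α, β ∈ \{1, 2\}$. -/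
def shilovIdeal (q : ℝ) : TwoSidedIdeal (PolMat2 q) :=
  TwoSidedIdeal.span {x | ∃ α β : Fin 2,
    x = (∑ j : Fin 2, ((q : ℂ) ^ (4 - (α.val + 1) - (β.val + 1))) • (z q j α * star (z q j β)))
      - (if α = β then 1 else 0)}

end PolMat2

/-! ### Operators on $\ell^2(\mathbb{Z}_+)$ -/

/-- The Hilbert space $\ell^2(\mathbb{Z}_+)$. -/
abbrev ell2 : Type := lp (fun _ : ℕ => ℂ) 2

/-- The basis vectors `e n`. -/
def e (n : ℕ) : ell2 := lp.single 2 n (1 : ℂ)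

theorem summable_sq (x : ell2) : Summable fun n => ‖x n‖ ^ 2 := by
  have := (lp.memℓp x).summable (by norm_num)
  simpa using this

theorem norm_sq_eq (x : ell2) : ‖x‖ ^ 2 = ∑' n, ‖x n‖ ^ 2 := by
  have := lp.norm_rpow_eq_tsum (p := 2) (by norm_num) x
  simpa using this

theorem memℓp_two {f : ℕ → ℂ} (hf : Summable fun n => ‖f n‖ ^ 2) :
    Memℓp (E := fun _ : ℕ => ℂ) f 2 :=
  memℓp_gen (by simpa using hf)

/-- The diagonal operator `e n ↦ w n • e n` for real weights with `|w n| ≤ 1`. -/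
def diag (w : ℕ → ℝ) (hw : ∀ n, |w n| ≤ 1) : ell2 →L[ℂ] ell2 :=
  have hle : ∀ (x : ell2) n, ‖(w n : ℂ) * x n‖ ^ 2 ≤ ‖x n‖ ^ 2 := fun x n => by
    rw [norm_mul, Complex.norm_real, Real.norm_eq_abs]
    exact pow_le_pow_left₀ (by positivity) (mul_le_of_le_one_left (norm_nonneg _) (hw n)) 2
  have hs : ∀ x : ell2, Summable fun n => ‖(w n : ℂ) * x n‖ ^ 2 := fun x =>
    Summable.of_nonneg_of_le (fun _ => by positivity) (hle x) (summable_sq x)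
  LinearMap.mkContinuous
    { toFun := fun x => ⟨fun n => (w n : ℂ) * x n, memℓp_two (hs x)⟩
      map_add' := fun x y => by ext n; exact mul_add _ _ _
      map_smul' := fun c x => by ext n; exact mul_left_comm _ _ _ } 1 fun x => by
    rw [one_mul, ← sq_le_sq₀ (norm_nonneg _) (norm_nonneg _), norm_sq_eq, norm_sq_eq]
    exact (hs x).tsum_le_tsum (hle x) (summable_sq x)

@[simp]
theorem diag_apply (w : ℕ → ℝ) (hw : ∀ n, |w n| ≤ 1) (x : ell2) (n : ℕ) :
    diag w hw x n = (w n : ℂ) * x n := rfl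

/-- The coordinates of the shifted sequence. -/
def shiftFun (x : ℕ → ℂ) : ℕ → ℂ
  | 0 => 0
  | n + 1 => x n

/-- The unilateral shift `S`, `S (e n) = e (n + 1)`. -/
def S : ell2 →L[ℂ] ell2 :=
  have hs : ∀ x : ell2, Summable fun n => ‖shiftFun x n‖ ^ 2 := fun x =>
    (summable_nat_add_iff 1).1 (summable_sq x)
  LinearMap.mkContinuous
    { toFun := fun x => ⟨shiftFun x, memℓp_two (hs x)⟩
      map_add' := fun x y => by
        ext n
        cases n with
        | zero => exact (add_zero (0 : ℂ)).symm
        | succ n => rfl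
      map_smul' := fun c x => by
        ext n
        cases n with
        | zero => exact (mul_zero c).symm
        | succ n => rfl } 1 fun x => by
    rw [one_mul, ← sq_le_sq₀ (norm_nonneg _) (norm_nonneg _), norm_sq_eq, norm_sq_eq]
    refine le_of_eq ?_
    change ∑' n, ‖shiftFun x n‖ ^ 2 = _
    rw [(hs x).tsum_eq_zero_add]
    simp [shiftFun]

@[simp]
theorem S_apply_zero (x : ell2) : S x 0 = 0 := rfl

@[simp]
theorem S_apply_succ (x : ell2) (n : ℕ) : S x (n + 1) = x n := rfl

theorem S_e (n : ℕ) : S (e n) = e (n + 1) := by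
  ext k
  cases k with
  | zero => simp [e, lp.single_apply]
  | succ k => simp [e, lp.single_apply, Pi.single_apply]

theorem diag_e (w : ℕ → ℝ) (hw : ∀ n, |w n| ≤ 1) (n : ℕ) : diag w hw (e n) = (w n : ℂ) • e n := by
  ext k
  rw [diag_apply, lp.coeFn_smul, Pi.smul_apply, smul_eq_mul]
  by_cases h : k = n
  · rw [h]
  · simp [e, lp.single_apply, h]

theorem apply_eq_inner (x : ell2) (n : ℕ) : x n = inner ℂ (e n) x := by
  simp [e, lp.inner_single_left]

@[simp]
theorem star_S_apply (x : ell2) (n : ℕ) : (star S : ell2 →L[ℂ] ell2) x n = x (n + 1) := by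
  rw [apply_eq_inner, ContinuousLinearMap.star_eq_adjoint,
    ContinuousLinearMap.adjoint_inner_right, S_e, ← apply_eq_inner]

@[simp]
theorem star_diag (w : ℕ → ℝ) (hw : ∀ n, |w n| ≤ 1) : star (diag w hw) = diag w hw := by
  ext x n
  rw [apply_eq_inner, ContinuousLinearMap.star_eq_adjoint,
    ContinuousLinearMap.adjoint_inner_right, diag_e, inner_smul_left, ← apply_eq_inner]
  simp

variable {q : ℝ} (hq : q ∈ Set.Ioo (0 : ℝ) 1)

/-- `C`, with `C (e n) = (1 - q ^ (2 n)) ^ (1/2) • e n`. -/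
def C : ell2 →L[ℂ] ell2 := diag (fun n => √(1 - q ^ (2 * n))) fun n => by
  rw [abs_of_nonneg (Real.sqrt_nonneg _), Real.sqrt_le_one]
  have := pow_nonneg hq.1.le (2 * n)
  linarith

/-- `d(q)`, with `d(q) (e n) = q ^ n • e n`. -/
def d : ell2 →L[ℂ] ell2 := diag (fun n => q ^ n) fun n => by
  rw [abs_of_nonneg (pow_nonneg hq.1.le n)]
  exact pow_le_one₀ hq.1.le hq.2.le

theorem C_e (n : ℕ) : C hq (e n) = ((√(1 - q ^ (2 * n)) : ℝ) : ℂ) • e n := diag_e _ _ n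

theorem d_e (n : ℕ) : d hq (e n) = ((q : ℂ) ^ n) • e n := by
  rw [d, diag_e, Complex.ofReal_pow]

@[simp]
theorem C_apply (x : ell2) (n : ℕ) : C hq x n = ((√(1 - q ^ (2 * n)) : ℝ) : ℂ) * x n := rfl

@[simp]
theorem d_apply (x : ell2) (n : ℕ) : d hq x n = (q : ℂ) ^ n * x n := by
  rw [d, diag_apply, Complex.ofReal_pow]

@[simp]
theorem star_C : star (C hq) = C hq := star_diag _ _

@[simp]
theorem star_d : star (d hq) = d hq := star_diag _ _

theorem sqrt_mul_self_cast {q : ℝ} (hq : q ∈ Set.Ioo (0 : ℝ) 1) (n : ℕ) :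
    ((√(1 - q ^ (2 * n)) : ℝ) : ℂ) * ((√(1 - q ^ (2 * n)) : ℝ) : ℂ) = 1 - ((q : ℂ) ^ n) ^ 2 := by
  rw [← Complex.ofReal_mul, Real.mul_self_sqrt]
  · push_cast; ring
  · have := pow_le_one₀ (n := 2 * n) hq.1.le hq.2.le
    linarith

/-- The scalar $e^{iφ}$. -/
def expI (φ : ℝ) : ℂ := Complex.exp (φ * Complex.I)

theorem expI_add (φ ψ : ℝ) : expI (φ + ψ) = expI φ * expI ψ := by
  simp [expI, add_mul, Complex.exp_add]

theorem expI_conj (φ : ℝ) : expI φ * conj (expI φ) = 1 := by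
  rw [Complex.mul_conj, expI, Complex.normSq_eq_norm_sq, Complex.norm_exp_ofReal_mul_I]
  simp

/-- The images of the generators under $ρ_{φ_1,φ_2}$. -/
def rhoGen (φ₁ φ₂ : ℝ) : Fin 2 → Fin 2 → (ell2 →L[ℂ] ell2) :=
  ![![(-expI (φ₁ + φ₂) * (q : ℂ)⁻¹) • (star S * C hq), expI φ₂ • d hq],
    ![expI φ₁ • d hq, C hq * S]]

theorem add_coord (T U : ell2 →L[ℂ] ell2) (x : ell2) (n : ℕ) :
    (T + U) x n = T x n + U x n := rfl

theorem sub_coord (T U : ell2 →L[ℂ] ell2) (x : ell2) (n : ℕ) :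
    (T - U) x n = T x n - U x n := rfl

theorem smul_coord (c : ℂ) (T : ell2 →L[ℂ] ell2) (x : ell2) (n : ℕ) :
    (c • T) x n = c * T x n := rfl

theorem mul_coord (T U : ell2 →L[ℂ] ell2) (x : ell2) (n : ℕ) :
    (T * U) x n = T (U x) n := rfl

theorem one_coord (x : ell2) (n : ℕ) : (1 : ell2 →L[ℂ] ell2) x n = x n := rfl

theorem rhoGen_rel (φ₁ φ₂ : ℝ) (a b : ell2 →L[ℂ] ell2)
    (h : MatRel q (rhoGen hq φ₁ φ₂) (fun i j => star (rhoGen hq φ₁ φ₂ i j)) a b) : a = b := by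
  have hq0 : (q : ℂ) ≠ 0 := by exact_mod_cast hq.1.ne'
  have hr : (q : ℂ) * (q : ℂ)⁻¹ = 1 := mul_inv_cancel₀ hq0
  have hu := expI_conj φ₁
  have hv := expI_conj φ₂
  have h00 : rhoGen hq φ₁ φ₂ 0 0
    = (-(expI φ₁ * expI φ₂) * (q : ℂ)⁻¹) • (star S * C hq) := by rw [← expI_add]; rfl
  have h01 : rhoGen hq φ₁ φ₂ 0 1 = expI φ₂ • d hq := rfl
  have h10 : rhoGen hq φ₁ φ₂ 1 0 = expI φ₁ • d hq := rfl
  have h11 : rhoGen hq φ₁ φ₂ 1 1 = C hq * S := rfl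
  obtain ⟨y, hy⟩ : ∃ y, y = fun i j => star (rhoGen hq φ₁ φ₂ i j) := ⟨_, rfl⟩
  rw [← hy] at h
  have k00 : y 0 0
      = (-(conj (expI φ₁) * conj (expI φ₂)) * (q : ℂ)⁻¹) • (C hq * S) := by
    have hS : star (star S * C hq) = C hq * S := by rw [star_mul, star_C, star_star]
    rw [hy]
    change star (rhoGen hq φ₁ φ₂ _ _) = _
    rw [h00, star_smul, hS]
    simp
  have k01 : y 0 1 = conj (expI φ₂) • d hq := by
    rw [hy]
    change star (rhoGen hq φ₁ φ₂ _ _) = _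
    rw [h01, star_smul, star_d]; rfl
  have k10 : y 1 0 = conj (expI φ₁) • d hq := by
    rw [hy]
    change star (rhoGen hq φ₁ φ₂ _ _) = _
    rw [h10, star_smul, star_d]; rfl
  have k11 : y 1 1 = star S * C hq := by
    rw [hy]
    change star (rhoGen hq φ₁ φ₂ _ _) = _
    rw [h11, star_mul, star_C]
  obtain ⟨c, hC, hcc⟩ : ∃ c : ℕ → ℂ, (∀ x n, C hq x n = c n * x n) ∧
      ∀ n, c n * c n = 1 - ((q : ℂ) ^ n) ^ 2 :=
    ⟨fun n => ((√(1 - q ^ (2 * n)) : ℝ) : ℂ), C_apply hq, sqrt_mul_self_cast hq⟩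
  cases h <;> ext x n <;>
    simp only [k00, k01, k10, k11, h00, h01, h10, h11, add_coord, sub_coord, smul_coord,
      mul_coord, one_coord, hC, d_apply, star_S_apply] <;>
    clear k00 k01 k10 k11 h00 h01 h10 h11 hy <;>
    generalize conj (expI φ₁) = u' at * <;>
    generalize conj (expI φ₂) = v' at * <;>
    generalize expI φ₁ = u at * <;>
    generalize expI φ₂ = v at * <;>
    have hs := hcc n <;>
    have ht := hcc (n + 1) <;>
    cases n <;>
    simp only [S_apply_zero, S_apply_succ, smul_coord, mul_coord, hC, d_apply,
      star_S_apply, pow_succ, mul_zero, zero_mul, sub_zero, add_zero, zero_add, pow_zero, mul_one, one_mul, mul_inv] at * <;>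
    generalize (q : ℂ)⁻¹ = r at * <;>
    clear hC hcc hq0 <;>
    grind only

/-- The representation $ρ_{φ_1,φ_2}$ of $Pol(Mat_2)_q$ on $\ell^2(\mathbb{Z}_+)$. -/
def rho (φ₁ φ₂ : ℝ) : PolMat2 q →⋆ₐ[ℂ] (ell2 →L[ℂ] ell2) :=
  PolMat2.lift (rhoGen hq φ₁ φ₂) (rhoGen_rel hq φ₁ φ₂)

/-- The images of the generators under $γ_{φ_1,φ_2}$. -/
def gammaGen (q φ₁ φ₂ : ℝ) : Fin 2 → Fin 2 → ℂ :=
  ![![expI φ₂ * (q : ℂ)⁻¹, 0],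
    ![0, expI φ₁]]

theorem gammaGen_rel {q : ℝ} (hq : q ∈ Set.Ioo (0 : ℝ) 1) (φ₁ φ₂ : ℝ) (a b : ℂ)
    (h : MatRel q (gammaGen q φ₁ φ₂) (fun i j => star (gammaGen q φ₁ φ₂ i j)) a b) : a = b := by
  have hq0 : (q : ℂ) ≠ 0 := by exact_mod_cast hq.1.ne'
  have hr : (q : ℂ) * (q : ℂ)⁻¹ = 1 := mul_inv_cancel₀ hq0
  have hu := expI_conj φ₁
  have hv := expI_conj φ₂
  cases h <;> simp [gammaGen] <;>
    generalize conj (expI φ₁) = u' at * <;>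
    generalize conj (expI φ₂) = v' at * <;>
    generalize expI φ₁ = u at * <;>
    generalize expI φ₂ = v at * <;>
    generalize (q : ℂ)⁻¹ = r at * <;>
    grind only

/-- The one-dimensional representation $γ_{φ_1,φ_2}$ of $Pol(Mat_2)_q$. -/
def gamma (φ₁ φ₂ : ℝ) : PolMat2 q →⋆ₐ[ℂ] ℂ :=
  PolMat2.lift (gammaGen q φ₁ φ₂) (gammaGen_rel hq φ₁ φ₂)

open PolMat2 in
theorem rho_z (φ₁ φ₂ : ℝ) :
    rho hq φ₁ φ₂ (z q 1 1) = C hq * S ∧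
    rho hq φ₁ φ₂ (z q 1 0) = expI φ₁ • d hq ∧
    rho hq φ₁ φ₂ (z q 0 1) = expI φ₂ • d hq ∧
    rho hq φ₁ φ₂ (z q 0 0) = (-expI (φ₁ + φ₂) * (q : ℂ)⁻¹) • (star S * C hq) :=
  ⟨lift_z _ _ 1 1, lift_z _ _ 1 0, lift_z _ _ 0 1, lift_z _ _ 0 0⟩

open PolMat2 in
theorem gamma_z (φ₁ φ₂ : ℝ) :
    gamma hq φ₁ φ₂ (z q 1 1) = expI φ₁ ∧
    gamma hq φ₁ φ₂ (z q 1 0) = 0 ∧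
    gamma hq φ₁ φ₂ (z q 0 1) = 0 ∧
    gamma hq φ₁ φ₂ (z q 0 0) = expI φ₂ * (q : ℂ)⁻¹ :=
  ⟨lift_z _ _ 1 1, lift_z _ _ 1 0, lift_z _ _ 0 1, lift_z _ _ 0 0⟩

/-- The Toeplitz algebra $C^*(S)$: the (unital) $C^*$-algebra generated by the shift. -/
def toeplitz : StarSubalgebra ℂ (ell2 →L[ℂ] ell2) := StarAlgebra.elemental ℂ S

theorem S_mem_toeplitz : S ∈ toeplitz := StarAlgebra.elemental.self_mem ℂ S

end

end QuantumBall

/-! Write `A`, `C`, `B`, `D` for the images of $z_2^2, z_1^2, z_2^1, z_1^1$ in a representation that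
annihilates $J$. Then `(A, C)` satisfies the relations of $SU_q(2)$, and `-q` times the quantum
determinant is a unitary `G` commuting with `A`, `C` and their adjoints, with `B = G C*` and `D =
-q⁻¹ G A*` (`exists_unitary_of_shilov`). Such a representation is thus an $SU_q(2)$ pair together
with a commuting unitary.

The kernel of `C` and its orthogonal complement reduce the pair. On the kernel `A` is unitary. On
the complement `C` is injective, and a Wold-type argument starting from the kernel of `A*` gives a
Hilbert sum of copies of `ell2` on which `A` is the weighted shift and `|C|` is `d(q)`
(`exists_isHilbertSum`); moreover `C = U |C|` with a unitary `U` commuting with `A` and `|C|`.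

Three unitaries remain to be replaced by scalars of modulus one: `G`, then `A` on the kernel of `C`,
and `U` on the complement. No spectral measure is needed. If `T` becomes `F u` when the unitary `V`
is replaced by `u`, then `T - F u` is a bounded multiple of `V - u`, uniformly in `u`. Discrete
Fourier sums of the vectors `V ^ k x` are approximate eigenvectors of `V`, whence `‖T‖ ≤ sup ‖F u‖`
(`IsFiberedOver.opNorm_le`). After the substitutions only multiples of some `rho` or some `gamma`
are left.

Part (2) handles `gamma`. Approximate eigenvectors of the shift for a point of the circle define a
character of $C^*(S)$. It kills `d(q)` and `C - 1`, which are diagonal with weights tending to zero,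
so it carries `rho` to `gamma`. Being contractive, it also bounds `gamma` by `rho`, as part (1)
requires. -/

namespace QuantumBall

/-! ### Replacing a unitary by scalars: a norm bound by discrete Fourier transform -/

section Localization

variable {H : Type*} [NormedAddCommGroup H] [InnerProductSpace ℂ H]

/-- Parseval's identity for the discrete Fourier transform of `N` vectors. -/
theorem sum_norm_sq_dft {N : ℕ} {ω : ℂ} (hω : IsPrimitiveRoot ω N) (hN : N ≠ 0) (x : ℕ → H) :
    ∑ j ∈ Finset.range N, ‖∑ k ∈ Finset.range N, (ω ^ j) ^ k • x k‖ ^ 2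
      = N * ∑ k ∈ Finset.range N, ‖x k‖ ^ 2 := by
  have hn : ‖ω‖ = 1 := hω.norm'_eq_one hN
  have hω0 : ω ≠ 0 := hω.ne_zero hN
  have hc : conj ω = ω⁻¹ := (Complex.inv_eq_conj hn).symm
  have key : ∀ k ∈ Finset.range N, ∀ l ∈ Finset.range N,
      ∑ j ∈ Finset.range N, conj ((ω ^ j) ^ k) * (ω ^ j) ^ l = if k = l then (N : ℂ) else 0 := by
    intro k hk l hl
    have h1 : ∀ j, conj ((ω ^ j) ^ k) * (ω ^ j) ^ l = ((ω⁻¹) ^ k * ω ^ l) ^ j := by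
      intro j
      rw [map_pow, map_pow, hc, mul_pow, ← pow_mul, ← pow_mul, ← pow_mul, ← pow_mul, mul_comm j k,
        mul_comm j l]
    simp only [h1]
    split_ifs with hkl
    · subst hkl
      simp [inv_pow, hω0]
    · have hne : (ω⁻¹) ^ k * ω ^ l ≠ 1 := by
        intro h
        apply hkl
        rw [inv_pow, inv_mul_eq_one₀ (pow_ne_zero _ hω0)] at h
        exact hω.pow_inj (Finset.mem_range.1 hk) (Finset.mem_range.1 hl) h
      rw [geom_sum_eq hne]
      have : ((ω⁻¹) ^ k * ω ^ l) ^ N = 1 := by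
        rw [mul_pow, ← pow_mul, ← pow_mul, mul_comm k, mul_comm l, pow_mul, pow_mul, inv_pow,
          hω.pow_eq_one]
        simp
      rw [this, sub_self, zero_div]
  have h2 : ∀ y : H, ((‖y‖ ^ 2 : ℝ) : ℂ) = inner ℂ y y := fun y => by
    rw [inner_self_eq_norm_sq_to_K]; simp
  apply Complex.ofReal_injective
  rw [Complex.ofReal_sum, Complex.ofReal_mul, Complex.ofReal_sum]
  simp only [h2, sum_inner, inner_sum, inner_smul_left, inner_smul_right]
  rw [Finset.sum_comm, Complex.ofReal_natCast, Finset.mul_sum]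
  refine Finset.sum_congr rfl fun k hk => ?_
  simp only [Finset.mul_sum]
  rw [Finset.sum_comm]
  have : ∀ l ∈ Finset.range N, ∑ j ∈ Finset.range N,
      (ω ^ j) ^ k * (conj ((ω ^ j) ^ l) * inner ℂ (x l) (x k))
        = if k = l then (N : ℂ) * inner ℂ (x k) (x k) else 0 := by
    intro l hl
    have h3 : ∀ j, (ω ^ j) ^ k * (conj ((ω ^ j) ^ l) * inner ℂ (x l) (x k))
        = conj ((ω ^ j) ^ l) * (ω ^ j) ^ k * inner ℂ (x l) (x k) := fun j => by ring
    simp only [h3]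
    rw [← Finset.sum_mul, key l hl k hk]
    by_cases h : k = l
    · simp [h]
    · simp [h, Ne.symm h]
  rw [Finset.sum_congr rfl this]
  simp only [Finset.sum_ite_eq, hk, if_true]

/-- The operator `T` commutes with `V` and is obtained from the family `F u` by
replacing the scalar `u` by `V`, up to a uniformly bounded multiple of `V - u`. -/
def IsFiberedOver (V T : H →L[ℂ] H) (F : Circle → H →L[ℂ] H) : Prop :=
  Commute T V ∧ ∃ L : ℝ, ∀ u : Circle, ∃ R : H →L[ℂ] H, ‖R‖ ≤ L ∧ ‖F u‖ ≤ L ∧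
    Commute (F u) V ∧ T - F u = R * (V - (u : ℂ) • 1)

namespace IsFiberedOver

variable {V T T' : H →L[ℂ] H} {F F' : Circle → H →L[ℂ] H}

theorem const (h : Commute T V) : IsFiberedOver V T fun _ => T :=
  ⟨h, ‖T‖, fun _ => ⟨0, by simp, le_rfl, h, by simp⟩⟩

theorem add (h : IsFiberedOver V T F) (h' : IsFiberedOver V T' F') :
    IsFiberedOver V (T + T') fun u => F u + F' u := by
  obtain ⟨hc, L, hL⟩ := h
  obtain ⟨hc', L', hL'⟩ := h'
  refine ⟨hc.add_left hc', L + L', fun u => ?_⟩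
  obtain ⟨R, h1, h2, h3, h4⟩ := hL u
  obtain ⟨R', h1', h2', h3', h4'⟩ := hL' u
  refine ⟨R + R', (norm_add_le _ _).trans (add_le_add h1 h1'),
    (norm_add_le _ _).trans (add_le_add h2 h2'), h3.add_left h3', ?_⟩
  rw [add_mul, ← h4, ← h4', add_sub_add_comm]

/-- From `T T' - F F' = T (T' - F') + (T - F) F'`: in the second term the factor `V - u` has to move
past `F' u`, which is why the fibres are required to commute with `V`. The constant bounds both the
remainder and the fibre. -/
theorem mul (h : IsFiberedOver V T F) (h' : IsFiberedOver V T' F') :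
    IsFiberedOver V (T * T') fun u => F u * F' u := by
  obtain ⟨hc, L, hL⟩ := h
  obtain ⟨hc', L', hL'⟩ := h'
  refine ⟨hc.mul_left hc', ‖T‖ * L' + L * L' + L * L', fun u => ?_⟩
  obtain ⟨R, h1, h2, h3, h4⟩ := hL u
  obtain ⟨R', h1', h2', h3', h4'⟩ := hL' u
  have l0 : 0 ≤ L := (norm_nonneg _).trans h1
  have l0' : 0 ≤ L' := (norm_nonneg _).trans h1'
  have b1 : ‖F u * F' u‖ ≤ L * L' := (norm_mul_le _ _).trans (mul_le_mul h2 h2' (norm_nonneg _) l0)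
  have b2 : ‖T * R'‖ ≤ ‖T‖ * L' :=
    (norm_mul_le _ _).trans (mul_le_mul_of_nonneg_left h1' (norm_nonneg _))
  have b3 : ‖R * F' u‖ ≤ L * L' := (norm_mul_le _ _).trans (mul_le_mul h1 h2' (norm_nonneg _) l0)
  refine ⟨T * R' + R * F' u, ?_, ?_, h3.mul_left h3', ?_⟩
  · have := norm_add_le (T * R') (R * F' u)
    nlinarith [mul_nonneg l0 l0']
  · nlinarith [mul_nonneg l0 l0', mul_nonneg (norm_nonneg T) l0']
  · have hcomm : F' u * (V - (u : ℂ) • 1) = (V - (u : ℂ) • 1) * F' u :=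
      (h3'.sub_right ((Commute.one_right (F' u)).smul_right (u : ℂ))).eq
    calc T * T' - F u * F' u = T * (T' - F' u) + (T - F u) * F' u := by noncomm_ring
      _ = T * (R' * (V - (u : ℂ) • 1)) + R * ((V - (u : ℂ) • 1) * F' u) := by rw [h4, h4', mul_assoc]
      _ = (T * R' + R * F' u) * (V - (u : ℂ) • 1) := by
        rw [← hcomm, add_mul, mul_assoc, mul_assoc]

/-- If `V` is isometric, then `T` is bounded by the supremum of the norms of its fibres. -/
theorem opNorm_le (h : IsFiberedOver V T F) (hV : ∀ x, ‖V x‖ = ‖x‖) {M : ℝ}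
    (hM : ∀ u, ‖F u‖ ≤ M) : ‖T‖ ≤ M := by
  obtain ⟨hc, L, hL⟩ := h
  have hM0 : 0 ≤ M := (norm_nonneg _).trans (hM 1)
  have hL0 : 0 ≤ L := by
    obtain ⟨R, h1, -⟩ := hL 1
    exact (norm_nonneg _).trans h1
  have hVk : ∀ (k : ℕ) x, ‖(V ^ k) x‖ = ‖x‖ := by
    intro k
    induction k with
    | zero => simp
    | succ k ih => intro x; rw [pow_succ', mul_apply_eq_comp, hV, ih]
  refine ContinuousLinearMap.opNorm_le_bound _ hM0 fun x => ?_
  have main : ∀ n : ℕ, ‖T x‖ ^ 2 ≤ (1 + 1 / ((n : ℝ) + 1)) * (M * ‖x‖) ^ 2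
      + (1 / ((n : ℝ) + 1) + (1 / ((n : ℝ) + 1)) ^ 2) * (L * (2 * ‖x‖)) ^ 2 := by
    intro n
    -- With `m = n + 1`, the inequality `b2` gives the error term the coefficient `1 + m`, and
    -- averaging divides it by `N`. The choice `N = m ^ 2` makes it vanish in the limit.
    obtain ⟨N, hN⟩ : ∃ N : ℕ, N = (n + 1) ^ 2 := ⟨_, rfl⟩
    have hN0 : N ≠ 0 := by rw [hN]; positivity
    obtain ⟨ω, hω⟩ : ∃ ω : ℂ, IsPrimitiveRoot ω N := ⟨_, Complex.isPrimitiveRoot_exp N hN0⟩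
    have hn : ‖ω‖ = 1 := hω.norm'_eq_one hN0
    have hω0 : ω ≠ 0 := hω.ne_zero hN0
    -- Approximate eigenvectors of `V` for `ω ^ (-j)`: the defect telescopes to two boundary terms
    -- of norm at most `2 * ‖x‖` in total, while the mean square of `‖y j‖` is `N * ‖x‖ ^ 2`.
    set y : ℕ → H := fun j => ∑ k ∈ Finset.range N, (ω ^ j) ^ k • (V ^ k) x with hy
    have hTy : ∀ j, T (y j) = ∑ k ∈ Finset.range N, (ω ^ j) ^ k • (V ^ k) (T x) := by
      intro j
      simp only [hy, map_sum, map_smul]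
      refine Finset.sum_congr rfl fun k _ => ?_
      rw [← mul_apply_eq_comp, (hc.pow_right k).eq, mul_apply_eq_comp]
    have s1 : ∑ j ∈ Finset.range N, ‖y j‖ ^ 2 = (N : ℝ) ^ 2 * ‖x‖ ^ 2 := by
      rw [sum_norm_sq_dft hω hN0]
      simp only [hVk, Finset.sum_const, Finset.card_range, nsmul_eq_mul]
      ring
    have s2 : ∑ j ∈ Finset.range N, ‖T (y j)‖ ^ 2 = (N : ℝ) ^ 2 * ‖T x‖ ^ 2 := by
      simp only [hTy]
      rw [sum_norm_sq_dft hω hN0]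
      simp only [hVk, Finset.sum_const, Finset.card_range, nsmul_eq_mul]
      ring
    have b : ∀ j, ‖T (y j)‖ ≤ M * ‖y j‖ + L * (2 * ‖x‖) := by
      intro j
      have hu : ‖(ω ^ j)⁻¹‖ = 1 := by simp [hn]
      obtain ⟨v, hv⟩ : ∃ v : Circle, (v : ℂ) = (ω ^ j)⁻¹ := ⟨⟨_, mem_sphere_zero_iff_norm.2 hu⟩, rfl⟩
      obtain ⟨R, h1, -, -, h4⟩ := hL v
      rw [hv] at h4
      have hw : ω ^ j ≠ 0 := pow_ne_zero _ hω0
      have hd : (V - (ω ^ j)⁻¹ • 1) (y j)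
          = (ω ^ j)⁻¹ • ((ω ^ j) ^ N • (V ^ N) x - x) := by
        have e1 : V (y j) = (ω ^ j)⁻¹ • ∑ k ∈ Finset.range N, (ω ^ j) ^ (k + 1) • (V ^ (k + 1)) x := by
          simp only [hy, map_sum, map_smul, Finset.smul_sum]
          refine Finset.sum_congr rfl fun k _ => ?_
          rw [smul_smul, pow_succ' (ω ^ j), inv_mul_cancel_left₀ hw, pow_succ' V,
            mul_apply_eq_comp]
        have e2 := Finset.sum_range_sub (fun k => (ω ^ j) ^ k • (V ^ k) x) N
        rw [Finset.sum_sub_distrib] at e2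
        rw [sub_apply, smul_apply,
          one_apply_eq_self, e1, ← smul_sub]
        congr 1
        simpa [hy] using e2
      have hd' : ‖(V - (ω ^ j)⁻¹ • 1) (y j)‖ ≤ 2 * ‖x‖ := by
        rw [hd, norm_smul, hu, one_mul]
        refine (norm_sub_le _ _).trans ?_
        rw [norm_smul, hVk, norm_pow, norm_pow, hn]
        simp; linarith
      have e : T (y j) = F v (y j) + R ((V - (ω ^ j)⁻¹ • 1) (y j)) := by
        have := congrArg (fun A : H →L[ℂ] H => A (y j)) h4
        simp only [sub_apply, mul_apply_eq_comp] at this ⊢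
        rw [← this]; abel
      rw [e]
      refine (norm_add_le _ _).trans (add_le_add ?_ ?_)
      · exact (ContinuousLinearMap.le_opNorm _ _).trans
          (mul_le_mul_of_nonneg_right (hM _) (norm_nonneg _))
      · exact (ContinuousLinearMap.le_opNorm _ _).trans
          (mul_le_mul h1 hd' (norm_nonneg _) hL0)
    have hn1 : (0 : ℝ) < (n : ℝ) + 1 := by positivity
    -- Young's inequality `(s + t)² ≤ (1 + 1/m) s² + (1 + m) t²`; it permits summing the squares
    -- over `j` and applying Parseval.
    have b2 : ∀ j, ‖T (y j)‖ ^ 2 ≤ (1 + 1 / ((n : ℝ) + 1)) * (M ^ 2 * ‖y j‖ ^ 2)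
        + (1 + ((n : ℝ) + 1)) * (L * (2 * ‖x‖)) ^ 2 := by
      intro j
      have h0 : 0 ≤ M * ‖y j‖ := by positivity
      have h1 : 0 ≤ L * (2 * ‖x‖) := by positivity
      generalize L * (2 * ‖x‖) = t at *
      have h2 := pow_le_pow_left₀ (norm_nonneg _) (b j) 2
      refine h2.trans ?_
      rw [← mul_pow]
      generalize M * ‖y j‖ = s at *
      have h3 : 0 ≤ (1 / ((n : ℝ) + 1)) * (s - ((n : ℝ) + 1) * t) ^ 2 := by positivity
      have h4 : (1 / ((n : ℝ) + 1)) * (s - ((n : ℝ) + 1) * t) ^ 2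
          = (1 / ((n : ℝ) + 1)) * s ^ 2 - 2 * s * t + ((n : ℝ) + 1) * t ^ 2 := by
        field_simp; ring
      nlinarith
    have s3 := Finset.sum_le_sum fun j (_ : j ∈ Finset.range N) => b2 j
    rw [s2, Finset.sum_add_distrib, ← Finset.mul_sum, ← Finset.mul_sum, s1] at s3
    simp only [Finset.sum_const, Finset.card_range, nsmul_eq_mul] at s3
    have hNr : (N : ℝ) = ((n : ℝ) + 1) ^ 2 := by rw [hN]; push_cast; ring
    rw [hNr] at s3
    generalize (n : ℝ) + 1 = m at *
    have hm4 : (0 : ℝ) < (m ^ 2) ^ 2 := by positivity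
    refine le_of_mul_le_mul_left (s3.trans (le_of_eq ?_)) hm4
    field_simp
    ring
  have lim : Filter.Tendsto (fun n : ℕ => (1 + 1 / ((n : ℝ) + 1)) * (M * ‖x‖) ^ 2
      + (1 / ((n : ℝ) + 1) + (1 / ((n : ℝ) + 1)) ^ 2) * (L * (2 * ‖x‖)) ^ 2) Filter.atTop
      (nhds ((1 + 0) * (M * ‖x‖) ^ 2 + (0 + 0 ^ 2) * (L * (2 * ‖x‖)) ^ 2)) := by
    have h0 := tendsto_one_div_add_atTop_nhds_zero_nat (𝕜 := ℝ)
    exact ((h0.const_add 1).mul_const _).add ((h0.add (h0.pow 2)).mul_const _)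
  have := ge_of_tendsto' lim main
  refine le_of_sq_le_sq ?_ (by positivity)
  simpa using this

end IsFiberedOver

end Localization

/-! ### Representations built from an $SU_q(2)$ pair and a scalar of modulus one -/

section QuantumPair

variable {B : Type*} [Ring B] [StarRing B] [Algebra ℂ B] [StarModule ℂ B]

/-- The defining relations of the quantum group `SU_q(2)` for a pair of elements. -/
structure IsQuantumPair (q : ℝ) (A C : B) : Prop where
  comm : C * A = (q : ℂ) • (A * C)
  star_comm : star A * C = (q : ℂ) • (C * star A)
  normal : star C * C = C * star C
  mul_star : A * star A = 1 - C * star C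
  star_mul : star A * A = 1 - (q : ℂ) ^ 2 • (C * star C)

namespace IsQuantumPair

variable {q : ℝ} {A C : B}

theorem star_star_comm (h : IsQuantumPair q A C) :
    star A * star C = (q : ℂ) • (star C * star A) := by
  have := congrArg star h.comm
  simpa [star_smul] using this

theorem comm_star (h : IsQuantumPair q A C) : star C * A = (q : ℂ) • (A * star C) := by
  have := congrArg star h.star_comm
  simpa [star_smul] using this

end IsQuantumPair

/-- The images of the generators of $Pol(Mat_2)_q$ under the representation determined by a
quantum pair and a scalar of modulus one. -/
noncomputable def pairGen (q : ℝ) (A C : B) (g : ℂ) : Fin 2 → Fin 2 → B :=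
  ![![(-((q : ℂ)⁻¹ * g)) • star A, C], ![g • star C, A]]

theorem pairGen_rel {q : ℝ} (hq : q ∈ Set.Ioo (0 : ℝ) 1) {A C : B} (h : IsQuantumPair q A C)
    {g : ℂ} (hg : ‖g‖ = 1) (a b : B)
    (hab : MatRel q (pairGen q A C g) (fun i j => star (pairGen q A C g i j)) a b) : a = b := by
  have hq0 : (q : ℂ) ≠ 0 := by exact_mod_cast hq.1.ne'
  have hr : (q : ℂ) * (q : ℂ)⁻¹ = 1 := mul_inv_cancel₀ hq0
  have hu : g * conj g = 1 := by rw [Complex.mul_conj, Complex.normSq_eq_norm_sq, hg]; simp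
  obtain ⟨y, hy⟩ : ∃ y, y = fun i j => star (pairGen q A C g i j) := ⟨_, rfl⟩
  rw [← hy] at hab
  have h00 : pairGen q A C g 0 0 = (-((q : ℂ)⁻¹ * g)) • star A := rfl
  have h01 : pairGen q A C g 0 1 = C := rfl
  have h10 : pairGen q A C g 1 0 = g • star C := rfl
  have h11 : pairGen q A C g 1 1 = A := rfl
  have k00 : y 0 0 = (-((q : ℂ)⁻¹ * conj g)) • A := by
    rw [hy]; change star (pairGen q A C g 0 0) = _
    rw [h00, star_smul, star_star]; simp
  have k01 : y 0 1 = star C := by rw [hy]; rfl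
  have k10 : y 1 0 = conj g • C := by
    rw [hy]; change star (pairGen q A C g 1 0) = _
    rw [h10, star_smul, star_star]; rfl
  have k11 : y 1 1 = star A := by rw [hy]; rfl
  cases hab <;>
    simp only [k00, k01, k10, k11, h00, h01, h10, h11, smul_mul_assoc, mul_smul_comm, h.comm,
      h.star_comm, h.normal, h.mul_star, h.star_mul, h.star_star_comm, h.comm_star] <;>
    clear k00 k01 k10 k11 h00 h01 h10 h11 hy <;>
    match_scalars <;>
    simp only [mul_one, mul_inv, mul_neg, neg_mul, pow_two] <;>
    -- With `conj g` and `q⁻¹` as free variables constrained by `hu` and `hr`, the comparison of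
    -- coefficients is polynomial algebra.
    generalize conj g = g' at * <;>
    generalize (q : ℂ)⁻¹ = r at * <;>
    clear hq0 <;>
    grind only

/-- The representation of $Pol(Mat_2)_q$ determined by a quantum pair and a scalar of modulus
one. -/
noncomputable def pairRep {q : ℝ} (hq : q ∈ Set.Ioo (0 : ℝ) 1) {A C : B} (h : IsQuantumPair q A C) {g : ℂ}
    (hg : ‖g‖ = 1) : PolMat2 q →⋆ₐ[ℂ] B :=
  PolMat2.lift (pairGen q A C g) (pairGen_rel hq h hg)

section
variable {q : ℝ} (hq : q ∈ Set.Ioo (0 : ℝ) 1) {A C : B} (h : IsQuantumPair q A C) {g : ℂ}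
    (hg : ‖g‖ = 1)

@[simp]
theorem pairRep_z (a α : Fin 2) : pairRep hq h hg (PolMat2.z q a α) = pairGen q A C g a α :=
  PolMat2.lift_z _ _ a α

end

/-- Induction principle: the generators and their adjoints generate $Pol(Mat_2)_q$. -/
theorem PolMat2.induction {q : ℝ} {P : PolMat2 q → Prop}
    (algebraMap : ∀ c : ℂ, P (algebraMap ℂ _ c))
    (gen : ∀ a α, P (PolMat2.z q a α)) (star_gen : ∀ a α, P (star (PolMat2.z q a α)))
    (mul : ∀ x y, P x → P y → P (x * y)) (add : ∀ x y, P x → P y → P (x + y))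
    (x : PolMat2 q) : P x := by
  obtain ⟨x, rfl⟩ := PolMat2.mk_surjective q x
  induction x using FreeAlgebra.induction with
  | grade0 c => rw [AlgHom.commutes]; exact algebraMap c
  | grade1 s =>
    rcases s with ⟨a, α⟩ | ⟨a, α⟩
    · exact gen a α
    · have := star_gen a α
      rwa [PolMat2.star_z] at this
  | mul x y hx hy => rw [map_mul]; exact mul _ _ hx hy
  | add x y hx hy => rw [map_add]; exact add _ _ hx hy

omit [StarModule ℂ B] in
theorem PolMat2.starAlgHom_ext {q : ℝ} {f g : PolMat2 q →⋆ₐ[ℂ] B}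
    (h : ∀ a α, f (PolMat2.z q a α) = g (PolMat2.z q a α)) : f = g := by
  ext x
  induction x using PolMat2.induction with
  | algebraMap c => rw [AlgHomClass.commutes, AlgHomClass.commutes]
  | gen a α => exact h a α
  | star_gen a α => rw [map_star, map_star, h]
  | mul x y hx hy => rw [map_mul, map_mul, hx, hy]
  | add x y hx hy => rw [map_add, map_add, hx, hy]

end QuantumPair

/-! ### Reduction of intertwining and fibering to the generators -/

section Intertwiners

variable {H H' : Type*} [NormedAddCommGroup H] [InnerProductSpace ℂ H] [CompleteSpace H]
  [NormedAddCommGroup H'] [InnerProductSpace ℂ H'] [CompleteSpace H']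

/-- The adjoints need a hypothesis of their own, because `W` is not assumed unitary; it will be the
inclusion of a subspace or of a copy of `ell2`. -/
theorem PolMat2.intertwines {q : ℝ} {π : PolMat2 q →⋆ₐ[ℂ] (H →L[ℂ] H)}
    {σ : PolMat2 q →⋆ₐ[ℂ] (H' →L[ℂ] H')} (W : H →L[ℂ] H')
    (h : ∀ a α x, W (π (PolMat2.z q a α) x) = σ (PolMat2.z q a α) (W x))
    (h' : ∀ a α x, W (star (π (PolMat2.z q a α)) x) = star (σ (PolMat2.z q a α)) (W x))
    (a : PolMat2 q) (x : H) : W (π a x) = σ a (W x) := by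
  induction a using PolMat2.induction generalizing x with
  | algebraMap c =>
    rw [AlgHomClass.commutes, AlgHomClass.commutes, Algebra.algebraMap_eq_smul_one,
      Algebra.algebraMap_eq_smul_one]
    simp
  | gen a α => exact h a α x
  | star_gen a α => rw [map_star, map_star]; exact h' a α x
  | mul a b ha hb => simp only [map_mul, mul_apply_eq_comp, ha, hb]
  | add a b ha hb => simp only [map_add, _root_.add_apply, ha, hb]

theorem pairRep_intertwines {q : ℝ} (hq : q ∈ Set.Ioo (0 : ℝ) 1) {A C : H →L[ℂ] H}
    {A' C' : H' →L[ℂ] H'} (h : IsQuantumPair q A C) (h' : IsQuantumPair q A' C') {g : ℂ}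
    (hg : ‖g‖ = 1) (W : H →L[ℂ] H') (hA : ∀ x, W (A x) = A' (W x))
    (hA' : ∀ x, W (star A x) = star A' (W x)) (hC : ∀ x, W (C x) = C' (W x))
    (hC' : ∀ x, W (star C x) = star C' (W x)) (a : PolMat2 q) (x : H) :
    W (pairRep hq h hg a x) = pairRep hq h' hg a (W x) := by
  refine PolMat2.intertwines W (fun a α x => ?_) (fun a α x => ?_) a x <;>
    simp only [pairRep_z] <;> fin_cases a <;> fin_cases α <;>
    simp [pairGen, hA, hA', hC, hC', star_smul]

/-- A star homomorphism whose values on the generators are fibered over `V` is fibered over `V`. -/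
theorem PolMat2.isFiberedOver {q : ℝ} {π : PolMat2 q →⋆ₐ[ℂ] (H →L[ℂ] H)}
    {σ : Circle → PolMat2 q →⋆ₐ[ℂ] (H →L[ℂ] H)} {V : H →L[ℂ] H}
    (h : ∀ a α, IsFiberedOver V (π (PolMat2.z q a α)) fun u => σ u (PolMat2.z q a α))
    (h' : ∀ a α, IsFiberedOver V (star (π (PolMat2.z q a α))) fun u => star (σ u (PolMat2.z q a α)))
    (a : PolMat2 q) : IsFiberedOver V (π a) fun u => σ u a := by
  induction a using PolMat2.induction with
  | algebraMap c =>
    simp only [AlgHomClass.commutes]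
    exact IsFiberedOver.const (Algebra.commutes c V)
  | gen a α => exact h a α
  | star_gen a α => simpa only [map_star] using h' a α
  | mul a b ha hb => simpa only [map_mul] using ha.mul hb
  | add a b ha hb => simpa only [map_add] using ha.add hb

end Intertwiners

/-! ### The algebra modulo the ideal: the quantum determinant as a central unitary -/

section ShilovRelations

variable {R : Type*} [Ring R] [StarRing R] [Algebra ℂ R] [StarModule ℂ R]

set_option linter.unusedSimpArgs false in
/-- In a `*`-algebra with the relations of $Pol(Mat_2)_q$ and of the Shilov boundary ideal, the
generators `z 1 1` and `z 0 1` form a quantum pair and the other two generators are obtained from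
them by means of a central unitary, a multiple of the quantum determinant. -/
theorem exists_unitary_of_shilov {q : ℝ} (hq : q ∈ Set.Ioo (0 : ℝ) 1) {z : Fin 2 → Fin 2 → R}
    (hz : ∀ a b, MatRel q z (fun i j => star (z i j)) a b → a = b)
    (J1 : (q : ℂ) ^ 2 • (z 0 0 * star (z 0 0) + z 1 0 * star (z 1 0)) = 1)
    (J2 : z 0 1 * star (z 0 1) + z 1 1 * star (z 1 1) = 1)
    (J3 : z 0 0 * star (z 0 1) + z 1 0 * star (z 1 1) = 0) :
    IsQuantumPair q (z 1 1) (z 0 1) ∧ ∃ G : R, star G * G = 1 ∧ G * star G = 1 ∧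
      Commute G (z 1 1) ∧ Commute G (star (z 1 1)) ∧ Commute G (z 0 1) ∧ Commute G (star (z 0 1)) ∧
      z 1 0 = G * star (z 0 1) ∧ z 0 0 = -(q : ℂ)⁻¹ • (G * star (z 1 1)) := by
  have hq0 : (q : ℂ) ≠ 0 := by exact_mod_cast hq.1.ne'
  have h2 := hz _ _ .h2
  have h3 := hz _ _ .h3
  have h4 := hz _ _ .h4
  have h5 := hz _ _ .h5
  have h6 := hz _ _ .h6
  have m1 := hz _ _ .m1
  have m2 := hz _ _ .m2
  have m3 := hz _ _ .m3
  have m4 := hz _ _ .m4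
  have c2 := hz _ _ .c2
  have c3s := congrArg star (hz _ _ .c3)
  have c4 := hz _ _ .c4
  have c4s := congrArg star c4
  have c5s := congrArg star (hz _ _ .c5)
  have c6s := congrArg star (hz _ _ .c6)
  have h2s := congrArg star h2
  clear hz
  generalize z 0 0 = D at *
  generalize z 1 0 = B at *
  generalize z 0 1 = C at *
  generalize z 1 1 = A at *
  simp only [star_mul, star_sub, star_smul, star_star, RCLike.star_def, map_sub, map_inv₀,
    Complex.conj_ofReal] at c3s c4s c5s c6s h2s
  have hN : star C * C = C * star C := by
    linear_combination (norm := skip) m3 - (1 - (q : ℂ) ^ 2) • J2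
    module
  have hL : A * star A = 1 - C * star C := by
    linear_combination (norm := skip) J2
    module
  have hS : star A * A = 1 - (q : ℂ) ^ 2 • (C * star C) := by
    linear_combination (norm := skip) m4 + (q : ℂ) ^ 2 • J2
    module
  refine ⟨⟨h6, c4, hN, hL, hS⟩, ?_⟩
  -- `Q` is the quantum determinant. Each identity below is certified by a combination of the
  -- relations multiplied on the left and on the right, since the ring is noncommutative.
  obtain ⟨Q, hQ⟩ : ∃ Q, Q = D * A - (q : ℂ) • (C * B) := ⟨_, rfl⟩
  have hD : Q * star A = D := by
    rw [hQ]
    linear_combination (norm := skip) D * J2 - (q : ℂ) • (C * J3) - h3 * star C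
    simp only [mul_add, add_mul, mul_sub, sub_mul, smul_mul_assoc, mul_smul_comm, smul_add,
      smul_sub, smul_smul, mul_assoc, mul_one, one_mul, mul_zero]
    module
  have hB : Q * star C = -(q : ℂ)⁻¹ • B := by
    rw [hQ]
    linear_combination (norm := skip) (q : ℂ)⁻¹ • (J3 * A) - (q : ℂ)⁻¹ • (D * c4s)
      - (q : ℂ)⁻¹ • (B * hS) + (q : ℂ) • (h2 * star C)
    simp only [mul_add, add_mul, mul_sub, sub_mul, smul_mul_assoc, mul_smul_comm, smul_add,
      smul_sub, smul_smul, mul_assoc, mul_one, one_mul, mul_zero, zero_mul]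
    match_scalars <;> field_simp <;> ring
  have hQA : Q * A = A * Q := by
    rw [hQ]
    linear_combination (norm := skip) h5 * A - (q : ℂ)⁻¹ • (C * h4) - h6 * B
    simp only [mul_add, add_mul, mul_sub, sub_mul, smul_mul_assoc, mul_smul_comm, smul_add,
      smul_sub, smul_smul, mul_assoc, mul_one, one_mul, mul_zero, zero_mul]
    match_scalars <;> field_simp <;> ring
  have hQA' : star A * Q = Q * star A := by
    rw [hD, hQ]
    linear_combination (norm := skip) c5s * A + D * hS - (q : ℂ) • (c4 * B)
      - (q : ℂ) ^ 2 • (C * c2) - (q : ℂ) ^ 3 • (C * J3) - (q : ℂ) ^ 2 • (h3 * star C)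
    simp only [mul_add, add_mul, mul_sub, sub_mul, smul_mul_assoc, mul_smul_comm, smul_add,
      smul_sub, smul_smul, mul_assoc, mul_one, one_mul, mul_zero, zero_mul]
    match_scalars <;> field_simp <;> ring
  have hQC : Q * C = C * Q := by
    rw [hQ]
    linear_combination (norm := skip) (q : ℂ)⁻¹ • (h3 * A) - (q : ℂ)⁻¹ • (D * h6)
      - (q : ℂ) • (C * h2)
    simp only [mul_add, add_mul, mul_sub, sub_mul, smul_mul_assoc, mul_smul_comm, smul_add,
      smul_sub, smul_smul, mul_assoc, mul_one, one_mul, mul_zero, zero_mul]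
    match_scalars <;> field_simp <;> ring
  have hQC' : Q * star C = star C * Q := by
    rw [hQ]
    linear_combination (norm := skip) -(c3s * A) - ((q : ℂ) - (q : ℂ)⁻¹) • (J3 * A)
      - (q : ℂ)⁻¹ • (D * c4s) + (q : ℂ) • (hN * B) + (q : ℂ) • (C * c6s)
    simp only [mul_add, add_mul, mul_sub, sub_mul, smul_mul_assoc, mul_smul_comm, smul_add,
      smul_sub, smul_smul, mul_assoc, mul_one, one_mul, mul_zero, zero_mul]
    match_scalars <;> field_simp <;> ring
  have hQQ : Q * star Q = ((q : ℂ) ^ 2)⁻¹ • 1 := by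
    have hQs : star Q = star A * star D - (q : ℂ) • (star B * star C) := by
      rw [hQ]; simp [star_smul]
    rw [hQs]
    linear_combination (norm := skip) hD * star D + (q : ℂ) • (Q * h2s) - (q : ℂ) • (hB * star B)
      + ((q : ℂ) ^ 2)⁻¹ • J1
    simp only [mul_add, add_mul, mul_sub, sub_mul, smul_mul_assoc, mul_smul_comm, smul_add,
      smul_sub, smul_smul, mul_assoc, mul_one, one_mul, mul_zero, zero_mul]
    match_scalars <;> field_simp <;> ring
  have hB' : B = -(q : ℂ) • (Q * star C) := by
    rw [hB, smul_smul]; simp [hq0]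
  have sA : star Q * A = A * star Q := by
    simpa using congrArg star hQA'
  have sA' : star Q * star A = star A * star Q := by
    simpa using congrArg star hQA.symm
  have sC : star Q * C = C * star Q := by
    simpa using congrArg star hQC'.symm
  have sC' : star Q * star C = star C * star Q := by
    simpa using congrArg star hQC.symm
  have hBB : B * star B = C * star C := by
    have e : star B = -(q : ℂ) • (C * star Q) := by rw [hB']; simp [star_smul]
    have e2 : Q * star C * (C * star Q) = Q * star Q * (C * star C) := by
      rw [← sC, mul_assoc, ← mul_assoc (star C), ← sC', mul_assoc, hN, ← mul_assoc]
    rw [e, hB', smul_mul_assoc, mul_smul_comm, smul_smul, e2, hQQ, smul_mul_assoc, one_mul,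
      smul_smul]
    rw [show -(q : ℂ) * -(q : ℂ) * ((q : ℂ) ^ 2)⁻¹ = 1 by field_simp, one_smul]
  have hDD : D * star D = ((q : ℂ) ^ 2)⁻¹ • (star A * A) := by
    rw [← hD, star_mul, star_star, ← sA, mul_assoc, ← mul_assoc (star A), ← sA', mul_assoc,
      ← mul_assoc, hQQ, smul_mul_assoc, one_mul]
  -- `star Q * Q` is reached only after multiplication by `A A*` or `C C*`, where it becomes `D* D`
  -- or a multiple of `B* B` and the relations `m1` and `m2` evaluate it. By `J2` the two
  -- multipliers add up to 1.
  have hEA : star Q * Q * (A * star A) = ((q : ℂ) ^ 2)⁻¹ • (A * star A) := by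
    have e : star D * D = star Q * Q * (A * star A) := by
      rw [← hD, star_mul, star_star, ← sA, mul_assoc, ← mul_assoc A, ← hQA, mul_assoc, ← mul_assoc]
    rw [← e, m1, hDD, hBB, hS, hL]
    match_scalars <;> field_simp <;> ring
  have hEC : star Q * Q * (C * star C) = ((q : ℂ) ^ 2)⁻¹ • (C * star C) := by
    have e : star B * B = (q : ℂ) ^ 2 • (star Q * Q * (C * star C)) := by
      have e1 : star B = -(q : ℂ) • (C * star Q) := by rw [hB']; simp [star_smul]
      rw [e1, hB', smul_mul_assoc, mul_smul_comm, smul_smul, ← sC, mul_assoc, ← mul_assoc C, ← hQC,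
        mul_assoc, ← mul_assoc (star Q)]
      congr 1
      ring
    have e2 : star B * B = C * star C := by
      rw [m2, hBB, hL]
      module
    have e3 := congrArg (fun x => ((q : ℂ) ^ 2)⁻¹ • x) (e.symm.trans e2)
    simpa only [smul_smul, inv_mul_cancel₀ (pow_ne_zero 2 hq0), one_smul] using e3
  have hE : star Q * Q = ((q : ℂ) ^ 2)⁻¹ • 1 := by
    rw [← mul_one (star Q * Q), ← J2, mul_add, hEA, hEC, smul_add]
  -- The factor `q` corrects `Q Q* = Q* Q = q⁻²`; the sign is the one that makes `B = G C*`.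
  refine ⟨-(q : ℂ) • Q, ?_, ?_, ?_, ?_, ?_, ?_, ?_, ?_⟩
  · rw [star_smul, smul_mul_assoc, mul_smul_comm, smul_smul, hE, smul_smul]
    rw [show star (-(q : ℂ)) * -(q : ℂ) * ((q : ℂ) ^ 2)⁻¹ = 1 by simp [pow_two]; field_simp,
      one_smul]
  · rw [star_smul, smul_mul_assoc, mul_smul_comm, smul_smul, hQQ, smul_smul]
    rw [show -(q : ℂ) * star (-(q : ℂ)) * ((q : ℂ) ^ 2)⁻¹ = 1 by simp [pow_two]; field_simp,
      one_smul]
  · exact Commute.smul_left hQA _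
  · exact Commute.smul_left hQA'.symm _
  · exact Commute.smul_left hQC _
  · exact Commute.smul_left hQC' _
  · rw [smul_mul_assoc]; exact hB'
  · rw [smul_mul_assoc, hD, smul_smul]; simp [hq0]

end ShilovRelations

open Filter Topology

/-! ### Characters from approximate joint eigenvectors -/

section Character

variable {H : Type*} [NormedAddCommGroup H] [InnerProductSpace ℂ H] [CompleteSpace H]

/-- The vectors `x n` are asymptotically joint eigenvectors of `T` and its adjoint, with
eigenvalues `c` and `conj c`. -/
def IsApproxEigen (x : ℕ → H) (T : H →L[ℂ] H) (c : ℂ) : Prop :=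
  Tendsto (fun n => T (x n) - c • x n) atTop (𝓝 0) ∧
    Tendsto (fun n => star T (x n) - conj c • x n) atTop (𝓝 0)

namespace IsApproxEigen

variable {x : ℕ → H} {T T' : H →L[ℂ] H} {c c' : ℂ}

theorem star (h : IsApproxEigen x T c) : IsApproxEigen x (star T) (conj c) := by
  refine ⟨h.2, ?_⟩
  simpa using h.1

theorem add (h : IsApproxEigen x T c) (h' : IsApproxEigen x T' c') :
    IsApproxEigen x (T + T') (c + c') := by
  constructor
  · convert h.1.add h'.1 using 2
    · simp only [_root_.add_apply, add_smul]; abel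
    · simp
  · convert h.2.add h'.2 using 2
    · simp only [star_add, map_add, _root_.add_apply, add_smul]; abel
    · simp

omit [CompleteSpace H] in
theorem tendsto_mul (h : Tendsto (fun n => T (x n) - c • x n) atTop (𝓝 0))
    (h' : Tendsto (fun n => T' (x n) - c' • x n) atTop (𝓝 0)) :
    Tendsto (fun n => (T * T') (x n) - (c * c') • x n) atTop (𝓝 0) := by
  convert ((T.continuous.tendsto _).comp h').add (h.const_smul c') using 2
  · simp only [mul_apply_eq_comp, Function.comp, map_sub, map_smul, smul_sub, smul_smul,
      mul_comm c]
    abel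
  · simp

theorem mul (h : IsApproxEigen x T c) (h' : IsApproxEigen x T' c') :
    IsApproxEigen x (T * T') (c * c') := by
  refine ⟨tendsto_mul h.1 h'.1, ?_⟩
  rw [star_mul, map_mul, mul_comm]
  exact tendsto_mul h'.2 h.2

theorem of_algebraMap (x : ℕ → H) (c : ℂ) : IsApproxEigen x (algebraMap ℂ (H →L[ℂ] H) c) c := by
  have : ∀ (c : ℂ) y, algebraMap ℂ (H →L[ℂ] H) c y = c • y := fun c y => by
    rw [Algebra.algebraMap_eq_smul_one]; rfl
  constructor
  · simp [this]
  · rw [← algebraMap_star_comm]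
    simp [this]

theorem neg (h : IsApproxEigen x T c) : IsApproxEigen x (-T) (-c) := by
  simpa using (of_algebraMap x (-1)).mul h

variable (hx : ∀ n, ‖x n‖ = 1)
include hx

/-- Applied to differences, this yields uniqueness of eigenvalues, their convergence along norm
limits, and contractivity of the resulting character. -/
theorem norm_le (h : IsApproxEigen x T c) : ‖c‖ ≤ ‖T‖ := by
  have h1 : ∀ n, ‖c‖ ≤ ‖T‖ + ‖T (x n) - c • x n‖ := by
    intro n
    have e1 : ‖c • x n‖ = ‖c‖ := by rw [norm_smul, hx, mul_one]
    have e2 : ‖T (x n)‖ ≤ ‖T‖ := by simpa [hx] using T.le_opNorm (x n)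
    have e3 := norm_sub_norm_le (c • x n) (T (x n))
    rw [norm_sub_rev] at e3
    linarith
  have := (h.1.norm).const_add ‖T‖
  simpa using ge_of_tendsto' this h1

theorem eigenvalue_unique (h : IsApproxEigen x T c) (h' : IsApproxEigen x T c') : c = c' := by
  have := (h.add h'.neg).norm_le hx
  rw [add_neg_cancel, norm_zero, norm_le_zero_iff] at this
  linear_combination this

/-- The eigenvalues are 1-Lipschitz in the operator by `norm_le`, hence Cauchy; the rest is an `ε /
3` argument, carried out for the operators and for their adjoints. -/
theorem exists_of_tendsto {T : ℕ → H →L[ℂ] H} {c : ℕ → ℂ} (h : ∀ k, IsApproxEigen x (T k) (c k))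
    {T₀ : H →L[ℂ] H} (hT : Tendsto T atTop (𝓝 T₀)) : ∃ c₀, IsApproxEigen x T₀ c₀ := by
  have hc : CauchySeq c := by
    rw [Metric.cauchySeq_iff]
    intro ε hε
    obtain ⟨N, hN⟩ := Metric.cauchySeq_iff.1 hT.cauchySeq ε hε
    refine ⟨N, fun m hm n hn => lt_of_le_of_lt ?_ (hN m hm n hn)⟩
    rw [dist_eq_norm, dist_eq_norm, sub_eq_add_neg, sub_eq_add_neg]
    exact ((h m).add (h n).neg).norm_le hx
  obtain ⟨c₀, hc₀⟩ := cauchySeq_tendsto_of_complete hc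
  have key : ∀ (U : ℕ → H →L[ℂ] H) (b : ℕ → ℂ) (U₀ : H →L[ℂ] H) (b₀ : ℂ),
      Tendsto U atTop (𝓝 U₀) → Tendsto b atTop (𝓝 b₀) →
      (∀ k, Tendsto (fun n => U k (x n) - b k • x n) atTop (𝓝 0)) →
      Tendsto (fun n => U₀ (x n) - b₀ • x n) atTop (𝓝 0) := by
    intro U b U₀ b₀ hU hb hk
    rw [Metric.tendsto_atTop]
    intro ε hε
    obtain ⟨k, hk1, hk2⟩ := (((Metric.tendsto_nhds.1 hU) (ε / 3) (by positivity)).and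
      ((Metric.tendsto_nhds.1 hb) (ε / 3) (by positivity))).exists
    obtain ⟨N, hN⟩ := Metric.tendsto_atTop.1 (hk k) (ε / 3) (by positivity)
    refine ⟨N, fun n hn => ?_⟩
    have h3 := hN n hn
    rw [dist_zero_right] at h3 ⊢
    rw [dist_comm, dist_eq_norm] at hk1
    rw [dist_eq_norm] at hk2
    have e : U₀ (x n) - b₀ • x n
        = (U₀ - U k) (x n) + (U k (x n) - b k • x n) + (b k - b₀) • x n := by
      simp only [_root_.sub_apply, sub_smul]; abel
    have e1 : ‖(U₀ - U k) (x n)‖ ≤ ‖U₀ - U k‖ := by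
      simpa [hx] using (U₀ - U k).le_opNorm (x n)
    have e2 : ‖(b k - b₀) • x n‖ = ‖b k - b₀‖ := by rw [norm_smul, hx, mul_one]
    rw [e]
    refine (norm_add₃_le).trans_lt ?_
    linarith
  refine ⟨c₀, key T c T₀ c₀ hT hc₀ fun k => (h k).1, ?_⟩
  exact key (fun k => Star.star (T k)) (fun k => conj (c k)) _ _ (hT.star)
    ((Complex.continuous_conj.tendsto _).comp hc₀) fun k => (h k).2

/-- A sequence of approximate joint eigenvectors of `V` and its adjoint defines a character of the
`C*`-algebra generated by `V`. -/
theorem exists_character {V : H →L[ℂ] H} {u : ℂ} (hV : IsApproxEigen x V u) :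
    ∃ Θ : StarAlgebra.elemental ℂ V →⋆ₐ[ℂ] ℂ, ∀ T : StarAlgebra.elemental ℂ V, IsApproxEigen x (T : H →L[ℂ] H) (Θ T) := by
  -- The operators with an approximate eigenvalue along `x` form a closed star subalgebra containing
  -- `V`, and uniqueness of the eigenvalue makes it multiplicative and additive.
  let A : StarSubalgebra ℂ (H →L[ℂ] H) :=
    { carrier := {T | ∃ c, IsApproxEigen x T c}
      mul_mem' := fun ⟨_, h⟩ ⟨_, h'⟩ => ⟨_, h.mul h'⟩
      add_mem' := fun ⟨_, h⟩ ⟨_, h'⟩ => ⟨_, h.add h'⟩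
      algebraMap_mem' := fun c => ⟨_, of_algebraMap x c⟩
      star_mem' := fun ⟨_, h⟩ => ⟨_, h.star⟩ }
  have hA : IsClosed (A : Set (H →L[ℂ] H)) := by
    refine isClosed_of_closure_subset fun T hT => ?_
    obtain ⟨U, hU, hT⟩ := mem_closure_iff_seq_limit.1 hT
    choose c hc using hU
    exact exists_of_tendsto hx hc hT
  have hle : StarAlgebra.elemental ℂ V ≤ A := StarAlgebra.elemental.le_of_mem hA ⟨u, hV⟩
  have hex : ∀ T : StarAlgebra.elemental ℂ V, ∃ c, IsApproxEigen x (T : H →L[ℂ] H) c :=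
    fun T => hle T.2
  choose θ hθ using hex
  refine ⟨{ toFun := θ, map_one' := ?_, map_mul' := ?_, map_zero' := ?_, map_add' := ?_,
            commutes' := ?_, map_star' := ?_ }, hθ⟩
  · refine (hθ 1).eigenvalue_unique hx ?_
    simpa using of_algebraMap x 1
  · exact fun S T => (hθ _).eigenvalue_unique hx ((hθ S).mul (hθ T))
  · refine (hθ 0).eigenvalue_unique hx ?_
    simpa using of_algebraMap x 0
  · exact fun S T => (hθ _).eigenvalue_unique hx ((hθ S).add (hθ T))
  · exact fun c => (hθ _).eigenvalue_unique hx (of_algebraMap x c)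
  · exact fun T => (hθ _).eigenvalue_unique hx (hθ T).star

end IsApproxEigen

end Character

/-! ### The Toeplitz algebra and its characters -/

section Toeplitz

theorem e_apply (n m : ℕ) : e n m = if m = n then (1 : ℂ) else 0 := by
  rw [e, lp.single_apply, Pi.single_apply]

theorem norm_e (n : ℕ) : ‖e n‖ = 1 := by
  simp [e]

theorem star_S_mul_S : star S * S = 1 := by
  ext x n
  rw [mul_coord, star_S_apply, S_apply_succ, one_coord]

/-- Every point of the unit circle is an approximate eigenvalue of the shift. -/
theorem exists_isApproxEigen_S (u : Circle) :
    ∃ x : ℕ → ell2, (∀ n, ‖x n‖ = 1) ∧ IsApproxEigen x S u := by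
  have hu : ‖(u : ℂ)‖ = 1 := Circle.norm_coe u
  have hu0 : (u : ℂ) ≠ 0 := Circle.coe_ne_zero u
  have hinv : conj (u : ℂ) = (u : ℂ)⁻¹ := (Complex.inv_eq_conj hu).symm
  -- Truncations of the formal eigenvector of `S`. Their norm is `√N`, while `S - u` leaves only two
  -- boundary terms, so normalisation makes the defect tend to zero.
  set y : ℕ → ell2 := fun N => ∑ k ∈ Finset.range N, ((u : ℂ)⁻¹) ^ k • e k with hy
  have hyn : ∀ N, ‖y N‖ ^ 2 = N := by
    intro N
    have : ∀ n, ‖y N n‖ ^ 2 = if n ∈ Finset.range N then (1 : ℝ) else 0 := by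
      intro n
      have h1 : y N n = ∑ k ∈ Finset.range N, ((u : ℂ)⁻¹) ^ k * e k n := by
        simp only [hy]
        rw [lp.coeFn_sum, Finset.sum_apply]
        rfl
      rw [h1]
      simp only [e_apply, mul_ite, mul_one, mul_zero, Finset.sum_ite_eq]
      split_ifs <;> simp [hu]
    rw [norm_sq_eq, tsum_congr this, tsum_eq_sum (s := Finset.range N)]
    · rw [Finset.sum_congr rfl fun n hn => if_pos hn]; simp
    · intro n hn; simp only [hn, if_false]
  have hSy : ∀ N, ‖S (y N) - (u : ℂ) • y N‖ ≤ 2 := by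
    intro N
    have e1 : S (y N) = (u : ℂ) • ∑ k ∈ Finset.range N, ((u : ℂ)⁻¹) ^ (k + 1) • e (k + 1) := by
      simp only [hy, map_sum, map_smul, S_e, Finset.smul_sum, smul_smul]
      refine Finset.sum_congr rfl fun k _ => ?_
      rw [pow_succ', mul_inv_cancel_left₀ hu0]
    have e2 := Finset.sum_range_sub (fun k => ((u : ℂ)⁻¹) ^ k • e k) N
    rw [Finset.sum_sub_distrib] at e2
    rw [e1, ← smul_sub, norm_smul, hu, one_mul]
    rw [show y N = ∑ k ∈ Finset.range N, ((u : ℂ)⁻¹) ^ k • e k from rfl, e2]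
    refine (norm_sub_le _ _).trans ?_
    rw [norm_smul, norm_smul, norm_e, norm_e]
    simp [hu]; norm_num
  set x : ℕ → ell2 := fun n => ((√((n : ℝ) + 1) : ℝ) : ℂ)⁻¹ • y (n + 1) with hx
  have hpos : ∀ n : ℕ, (0 : ℝ) < √((n : ℝ) + 1) := fun n => Real.sqrt_pos.2 (by positivity)
  have hx1 : ∀ n, ‖x n‖ = 1 := by
    intro n
    have h1 : ‖y (n + 1)‖ = √((n : ℝ) + 1) := by
      rw [← Real.sqrt_sq (norm_nonneg (y (n + 1))), hyn]; push_cast; rfl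
    rw [hx]
    simp only [norm_smul, norm_inv, Complex.norm_real, Real.norm_eq_abs, abs_of_pos (hpos n), h1]
    exact inv_mul_cancel₀ (hpos n).ne'
  have hSx : Tendsto (fun n => S (x n) - (u : ℂ) • x n) atTop (𝓝 0) := by
    have lim : Tendsto (fun n : ℕ => (√((n : ℝ) + 1))⁻¹ * 2) atTop (𝓝 (0 * 2)) := by
      refine Tendsto.mul_const _ (tendsto_inv_atTop_zero.comp ?_)
      exact Real.tendsto_sqrt_atTop.comp
        (tendsto_atTop_add_const_right _ _ tendsto_natCast_atTop_atTop)
    rw [zero_mul] at lim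
    refine squeeze_zero_norm (fun n => ?_) lim
    have e1 : S (x n) - (u : ℂ) • x n
        = ((√((n : ℝ) + 1) : ℝ) : ℂ)⁻¹ • (S (y (n + 1)) - (u : ℂ) • y (n + 1)) := by
      rw [hx]
      simp only [map_smul, smul_sub, smul_smul, mul_comm]
    rw [e1, norm_smul, norm_inv, Complex.norm_real, Real.norm_eq_abs, abs_of_pos (hpos n)]
    exact mul_le_mul_of_nonneg_left (hSy _) (inv_nonneg.2 (hpos n).le)
  refine ⟨x, hx1, hSx, ?_⟩
  -- Since `S* S = 1`, one has `S* x - u⁻¹ x = -u⁻¹ S* (S x - u x)`.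
  have h2 := (((star S : ell2 →L[ℂ] ell2).continuous.tendsto _).comp hSx).const_smul (-(u : ℂ)⁻¹)
  convert h2 using 2 with n
  · have : star S (S (x n)) = x n := by
      rw [← mul_apply_eq_comp, star_S_mul_S]; rfl
    simp only [Function.comp, map_sub, map_smul, this, smul_sub, smul_smul, hinv]
    simp [hu0]
    abel
  · simp

/-- Consecutive differences of these projections are the coordinate projections, which places them
in the algebra generated by the shift. -/
theorem S_pow_apply (n : ℕ) (x : ell2) (m : ℕ) :
    (S ^ n * star S ^ n) x m = if n ≤ m then x m else 0 := by
  induction n generalizing x m with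
  | zero => simp
  | succ n ih =>
    have : S ^ (n + 1) * star S ^ (n + 1) = S * (S ^ n * star S ^ n) * star S := by
      rw [pow_succ', pow_succ]; simp only [mul_assoc]
    rw [this, mul_coord, mul_coord]
    cases m with
    | zero => simp
    | succ m => rw [S_apply_succ, ih]; simp

theorem norm_le_of_coord_le {T : ell2 →L[ℂ] ell2} {c : ℝ} (hc : 0 ≤ c)
    (h : ∀ x n, ‖T x n‖ ≤ c * ‖x n‖) : ‖T‖ ≤ c := by
  refine ContinuousLinearMap.opNorm_le_bound _ hc fun x => ?_
  refine le_of_sq_le_sq ?_ (by positivity)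
  rw [mul_pow, norm_sq_eq, norm_sq_eq, ← tsum_mul_left]
  refine (summable_sq _).tsum_le_tsum (fun n => ?_) ((summable_sq x).mul_left _)
  rw [← mul_pow]
  exact pow_le_pow_left₀ (norm_nonneg _) (h x n) 2

/-- A diagonal operator whose weights tend to zero is a norm limit of combinations of the
projections `S ^ n * star S ^ n - S ^ (n + 1) * star S ^ (n + 1)`. -/
theorem tendsto_diag {w : ℕ → ℝ} (hw : ∀ n, |w n| ≤ 1) (h0 : Tendsto w atTop (𝓝 0)) :
    Tendsto (fun N => ∑ n ∈ Finset.range N,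
      (w n : ℂ) • (S ^ n * star S ^ n - S ^ (n + 1) * star S ^ (n + 1))) atTop (𝓝 (diag w hw)) := by
  rw [Metric.tendsto_atTop]
  intro ε hε
  obtain ⟨N, hN⟩ := Metric.tendsto_atTop.1 h0 (ε / 2) (by positivity)
  refine ⟨N, fun M hM => ?_⟩
  rw [dist_comm, dist_eq_norm]
  refine lt_of_le_of_lt (norm_le_of_coord_le (c := ε / 2) (by positivity) fun x m => ?_)
    (by linarith)
  have e1 : (∑ n ∈ Finset.range M,
      (w n : ℂ) • (S ^ n * star S ^ n - S ^ (n + 1) * star S ^ (n + 1))) x m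
      = if m ∈ Finset.range M then (w m : ℂ) * x m else 0 := by
    rw [_root_.sum_apply, lp.coeFn_sum, Finset.sum_apply]
    have : ∀ n ∈ Finset.range M,
        ((w n : ℂ) • (S ^ n * star S ^ n - S ^ (n + 1) * star S ^ (n + 1))) x m
          = if m = n then (w m : ℂ) * x m else 0 := by
      intro n _
      rw [smul_coord, sub_coord, S_pow_apply, S_pow_apply]
      rcases lt_trichotomy m n with h | h | h
      · simp [h.ne, show ¬ n ≤ m by omega, show ¬ n + 1 ≤ m by omega]
      · subst h; simp
      · simp [h.ne', show n ≤ m by omega, show n + 1 ≤ m by omega]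
    rw [Finset.sum_congr rfl this, Finset.sum_ite_eq]
  rw [sub_coord, diag_apply, e1]
  split_ifs with hm
  · simp; positivity
  · have hm' : N ≤ m := by simp at hm; omega
    have := hN m hm'
    rw [Real.dist_eq, sub_zero] at this
    rw [sub_zero, norm_mul, Complex.norm_real, Real.norm_eq_abs]
    exact mul_le_mul_of_nonneg_right this.le (norm_nonneg _)

theorem diag_mem_toeplitz {w : ℕ → ℝ} (hw : ∀ n, |w n| ≤ 1) (h0 : Tendsto w atTop (𝓝 0)) :
    diag w hw ∈ toeplitz := by
  have hc : IsClosed (toeplitz : Set (ell2 →L[ℂ] ell2)) := StarAlgebra.elemental.isClosed ℂ S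
  refine hc.mem_of_tendsto (tendsto_diag hw h0) (Eventually.of_forall fun N => ?_)
  refine sum_mem fun n _ => SMulMemClass.smul_mem _ (sub_mem (mul_mem ?_ ?_) (mul_mem ?_ ?_))
  all_goals first
    | exact pow_mem S_mem_toeplitz _
    | exact pow_mem (star_mem S_mem_toeplitz) _

/-- Diagonal operators whose weights tend to zero annihilate approximate eigenvectors of the shift. -/
theorem isApproxEigen_diag {x : ℕ → ell2} (hx : ∀ n, ‖x n‖ = 1) {u : Circle}
    (h : IsApproxEigen x S u) {w : ℕ → ℝ} (hw : ∀ n, |w n| ≤ 1) (h0 : Tendsto w atTop (𝓝 0)) :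
    IsApproxEigen x (diag w hw) 0 := by
  have hpow : ∀ {T : ell2 →L[ℂ] ell2} {c : ℂ}, IsApproxEigen x T c → ∀ n : ℕ,
      IsApproxEigen x (T ^ n) (c ^ n) := by
    intro T c hT n
    induction n with
    | zero => simpa using IsApproxEigen.of_algebraMap x 1
    | succ n ih => rw [pow_succ, pow_succ]; exact ih.mul hT
  -- As `|u| = 1`, each of these projections has eigenvalue 1, so their differences have eigenvalue
  -- 0, and so does the norm limit.
  have hP : ∀ n, IsApproxEigen x (S ^ n * star S ^ n) 1 := by
    intro n
    have := (hpow h n).mul (hpow h.star n)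
    rwa [← mul_pow, Complex.mul_conj, Complex.normSq_eq_norm_sq, Circle.norm_coe, one_pow,
      Complex.ofReal_one, one_pow] at this
  have hE : ∀ N, IsApproxEigen x (∑ n ∈ Finset.range N,
      (w n : ℂ) • (S ^ n * star S ^ n - S ^ (n + 1) * star S ^ (n + 1))) 0 := by
    intro N
    induction N with
    | zero => simpa using IsApproxEigen.of_algebraMap x 0
    | succ N ih =>
      rw [Finset.sum_range_succ]
      have := ih.add ((IsApproxEigen.of_algebraMap x (w N : ℂ)).mul ((hP N).add (hP (N + 1)).neg))
      simpa only [Algebra.algebraMap_eq_smul_one, sub_eq_add_neg, smul_mul_assoc, one_mul, add_neg_cancel,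
        mul_zero, add_zero] using this
  obtain ⟨c₀, hc₀⟩ := IsApproxEigen.exists_of_tendsto hx hE (tendsto_diag hw h0)
  have hz : ∀ N, ‖c₀‖ ≤ ‖diag w hw - ∑ n ∈ Finset.range N,
      (w n : ℂ) • (S ^ n * star S ^ n - S ^ (n + 1) * star S ^ (n + 1))‖ := by
    intro N
    have := (hc₀.add (hE N).neg).norm_le hx
    simpa [sub_eq_add_neg] using this
  have lim := ((tendsto_diag hw h0).const_sub (diag w hw)).norm
  rw [sub_self, norm_zero] at lim
  have := ge_of_tendsto' lim hz
  rw [norm_le_zero_iff] at this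
  rwa [this] at hc₀

variable {q : ℝ} (hq : q ∈ Set.Ioo (0 : ℝ) 1)

/-- The character of an approximate eigenvector of `S` for `e^{iφ₁}` sends `d(q)` to 0 and `C` to 1;
comparison with `gamma` is then needed only on generators. The contractivity clause serves the norm
estimate in part (1). -/
theorem exists_toeplitz_character (φ₁ φ₂ : ℝ) : ∃ Θ : toeplitz →⋆ₐ[ℂ] ℂ,
    (∀ T, ‖Θ T‖ ≤ ‖(T : ell2 →L[ℂ] ell2)‖) ∧
    Θ ⟨S, S_mem_toeplitz⟩ = expI φ₁ ∧ ∀ a : PolMat2 q,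
      ∃ h : rho hq φ₁ (Real.pi + φ₂) a ∈ toeplitz,
        Θ ⟨rho hq φ₁ (Real.pi + φ₂) a, h⟩ = gamma hq φ₁ φ₂ a := by
  obtain ⟨x, hx, hS⟩ := exists_isApproxEigen_S (Circle.exp φ₁)
  obtain ⟨Θ, hΘ⟩ : ∃ Θ : toeplitz →⋆ₐ[ℂ] ℂ, ∀ T : toeplitz,
      IsApproxEigen x (T : ell2 →L[ℂ] ell2) (Θ T) := IsApproxEigen.exists_character hx hS
  have hval : ∀ {T : ell2 →L[ℂ] ell2} (hT : T ∈ toeplitz) {c : ℂ}, IsApproxEigen x T c →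
      Θ (⟨T, hT⟩ : toeplitz) = c := fun hT c hc => (hΘ (⟨_, hT⟩ : toeplitz)).eigenvalue_unique hx hc
  have hu : ((Circle.exp φ₁ : Circle) : ℂ) = expI φ₁ := by rw [Circle.coe_exp]; rfl
  rw [hu] at hS
  have hpow : Tendsto (fun n : ℕ => q ^ n) atTop (𝓝 0) :=
    tendsto_pow_atTop_nhds_zero_of_lt_one hq.1.le hq.2
  have hd : d hq ∈ toeplitz := diag_mem_toeplitz _ hpow
  rw [← hu] at hS
  have hd' : IsApproxEigen x (d hq) 0 := isApproxEigen_diag hx hS _ hpow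
  have hle : ∀ n, q ^ (2 * n) ≤ 1 := fun n => pow_le_one₀ hq.1.le hq.2.le
  have hw : ∀ n, |1 - √(1 - q ^ (2 * n))| ≤ 1 := by
    intro n
    have h1 := Real.sqrt_nonneg (1 - q ^ (2 * n))
    have h2 : √(1 - q ^ (2 * n)) ≤ 1 := by
      rw [Real.sqrt_le_one]
      have := pow_nonneg hq.1.le (2 * n)
      linarith
    rw [abs_le]
    constructor <;> linarith
  have hw0 : Tendsto (fun n => 1 - √(1 - q ^ (2 * n))) atTop (𝓝 0) := by
    have h1 : Tendsto (fun n : ℕ => q ^ (2 * n)) atTop (𝓝 0) := by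
      simp only [pow_mul]
      exact tendsto_pow_atTop_nhds_zero_of_lt_one (by positivity) (by nlinarith [hq.1, hq.2])
    have h2 := ((h1.const_sub 1).sqrt).const_sub 1
    simpa using h2
  -- The weights of `C` tend to 1, so it is `1 - C` that the limit argument covers.
  have hCe : C hq = 1 + -diag _ hw := by
    ext y n
    rw [add_coord, one_coord, ← neg_one_smul ℂ (diag _ hw), smul_coord, diag_apply, C_apply]
    push_cast
    ring
  have hC : C hq ∈ toeplitz := by
    rw [hCe]
    exact add_mem (one_mem _) (neg_mem (diag_mem_toeplitz hw hw0))
  have hC' : IsApproxEigen x (C hq) 1 := by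
    rw [hCe]
    simpa using (IsApproxEigen.of_algebraMap x 1).add (isApproxEigen_diag hx hS hw hw0).neg
  have hS' := S_mem_toeplitz
  rw [hu] at hS
  have smul : ∀ {T : ell2 →L[ℂ] ell2} {c : ℂ} (k : ℂ), IsApproxEigen x T c →
      IsApproxEigen x (k • T) (k * c) := by
    intro T c k hT
    simpa [Algebra.algebraMap_eq_smul_one] using (IsApproxEigen.of_algebraMap x k).mul hT
  obtain ⟨r11, r10, r01, r00⟩ := rho_z hq φ₁ (Real.pi + φ₂)
  obtain ⟨g11, g10, g01, g00⟩ := gamma_z hq φ₁ φ₂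
  have gen : ∀ a α, rho hq φ₁ (Real.pi + φ₂) (PolMat2.z q a α) ∈ toeplitz ∧
      IsApproxEigen x (rho hq φ₁ (Real.pi + φ₂) (PolMat2.z q a α))
        (gamma hq φ₁ φ₂ (PolMat2.z q a α)) := by
    intro a α
    fin_cases a <;> fin_cases α
    · simp only [Fin.zero_eta, r00, g00]
      refine ⟨SMulMemClass.smul_mem _ (mul_mem (star_mem hS') hC), ?_⟩
      have := smul (-expI (φ₁ + (Real.pi + φ₂)) * (q : ℂ)⁻¹) (hS.star.mul hC')
      convert this using 1
      -- The shift of the second angle by π cancels the sign of `z 0 0` in `rho`.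
      have hpi : expI Real.pi = -1 := Complex.exp_pi_mul_I
      rw [expI_add, expI_add, hpi]
      linear_combination (-expI φ₂ * (q : ℂ)⁻¹) * expI_conj φ₁
    · simp only [Fin.zero_eta, Fin.mk_one, r01, g01]
      exact ⟨SMulMemClass.smul_mem _ hd, by simpa using smul (expI (Real.pi + φ₂)) hd'⟩
    · simp only [Fin.zero_eta, Fin.mk_one, r10, g10]
      exact ⟨SMulMemClass.smul_mem _ hd, by simpa using smul (expI φ₁) hd'⟩
    · simp only [Fin.mk_one, r11, g11]
      exact ⟨mul_mem hC hS', by simpa using hC'.mul hS⟩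
  have all : ∀ a, rho hq φ₁ (Real.pi + φ₂) a ∈ toeplitz ∧
      IsApproxEigen x (rho hq φ₁ (Real.pi + φ₂) a) (gamma hq φ₁ φ₂ a) := by
    intro a
    induction a using PolMat2.induction with
    | algebraMap c =>
      rw [AlgHomClass.commutes, AlgHomClass.commutes]
      exact ⟨algebraMap_mem _ c, IsApproxEigen.of_algebraMap x c⟩
    | gen a α => exact gen a α
    | star_gen a α =>
      rw [map_star, map_star]
      exact ⟨star_mem (gen a α).1, (gen a α).2.star⟩
    | mul a b ha hb =>
      rw [map_mul, map_mul]
      exact ⟨mul_mem ha.1 hb.1, ha.2.mul hb.2⟩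
    | add a b ha hb =>
      rw [map_add, map_add]
      exact ⟨add_mem ha.1 hb.1, ha.2.add hb.2⟩
  exact ⟨Θ, fun T => (hΘ T).norm_le hx, hval _ hS, fun a => ⟨(all a).1, hval _ (all a).2⟩⟩

theorem norm_gamma_le (φ₁ φ₂ : ℝ) (a : PolMat2 q) :
    ‖gamma hq φ₁ φ₂ a‖ ≤ ‖rho hq φ₁ (Real.pi + φ₂) a‖ := by
  obtain ⟨Θ, hΘ, -, h⟩ := exists_toeplitz_character hq φ₁ φ₂
  obtain ⟨hm, he⟩ := h a
  rw [← he]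
  exact hΘ ⟨_, hm⟩

end Toeplitz

/-! ### Fibering of a unitary and its adjoint over itself -/

section Fibered

variable {H : Type*} [NormedAddCommGroup H] [InnerProductSpace ℂ H]

namespace IsFiberedOver

variable {V T : H →L[ℂ] H} {F F' : Circle → H →L[ℂ] H}

theorem congr (h : IsFiberedOver V T F) {T' : H →L[ℂ] H} (hT : T = T') (hF : ∀ u, F u = F' u) :
    IsFiberedOver V T' F' := by
  rwa [← hT, ← funext hF]

theorem smul (c : ℂ) (h : IsFiberedOver V T F) : IsFiberedOver V (c • T) fun u => c • F u := by
  have := (IsFiberedOver.const (Algebra.commutes c V)).mul h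
  simpa [Algebra.algebraMap_eq_smul_one] using this

/-- Only an inequality, since `H` may be the zero space. -/
theorem norm_smul_one_le (u : ℂ) : ‖u • (1 : H →L[ℂ] H)‖ ≤ ‖u‖ := by
  rw [norm_smul]
  exact mul_le_of_le_one_right (norm_nonneg _) ContinuousLinearMap.norm_id_le

theorem self (V : H →L[ℂ] H) : IsFiberedOver V V fun u => (u : ℂ) • 1 :=
  ⟨Commute.refl V, 1, fun u => ⟨1, ContinuousLinearMap.norm_id_le,
    (norm_smul_one_le _).trans (Circle.norm_coe u).le,
    (Commute.one_left V).smul_left (u : ℂ), (one_mul _).symm⟩⟩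

/-- Because `V* - ū = -ū V* (V - u)` for a unitary `V` and `|u| = 1`. -/
theorem star_self [CompleteSpace H] (h : star V * V = 1) (h' : V * star V = 1) :
    IsFiberedOver V (star V) fun u => conj (u : ℂ) • 1 := by
  refine ⟨h.trans h'.symm, 1 + ‖star V‖, fun u => ⟨-(conj (u : ℂ) • star V), ?_, ?_,
    (Commute.one_left V).smul_left _, ?_⟩⟩
  · rw [norm_neg, norm_smul, RCLike.norm_conj, Circle.norm_coe, one_mul]
    linarith
  · refine (norm_smul_one_le _).trans ?_
    rw [RCLike.norm_conj, Circle.norm_coe]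
    linarith [norm_nonneg (star V)]
  · have hu : conj (u : ℂ) * (u : ℂ) = 1 := by
      rw [mul_comm, Complex.mul_conj, Complex.normSq_eq_norm_sq, Circle.norm_coe]; simp
    rw [neg_mul, mul_sub, smul_mul_assoc, h, mul_smul_comm, mul_one, smul_smul, mul_comm (u : ℂ), hu,
      one_smul]
    abel

end IsFiberedOver

theorem norm_apply_of_star_mul_self [CompleteSpace H] {V : H →L[ℂ] H} (h : star V * V = 1) (x : H) :
    ‖V x‖ = ‖x‖ :=
  (ContinuousLinearMap.norm_map_iff_adjoint_comp_self V).2 h x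

end Fibered

/-! ### The representations `rho` as pair representations -/

section ShiftPair

variable {q : ℝ} (hq : q ∈ Set.Ioo (0 : ℝ) 1)

theorem norm_expI (φ : ℝ) : ‖expI φ‖ = 1 := Complex.norm_exp_ofReal_mul_I φ

theorem expI_eq_circle (φ : ℝ) : expI φ = (Circle.exp φ : ℂ) := by rw [Circle.coe_exp]; rfl

theorem exists_expI_eq (u : ℂ) (hu : ‖u‖ = 1) : ∃ φ : ℝ, expI φ = u := by
  refine ⟨Complex.arg u, ?_⟩
  have := Complex.norm_mul_exp_arg_mul_I u
  rwa [hu, Complex.ofReal_one, one_mul] at this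

theorem exists_expI_eq_mem_Ico (φ : ℝ) : ∃ ψ ∈ Set.Ico (0 : ℝ) (2 * Real.pi), expI ψ = expI φ := by
  refine ⟨toIcoMod Real.two_pi_pos 0 φ, by simpa using toIcoMod_mem_Ico Real.two_pi_pos 0 φ, ?_⟩
  rw [expI_eq_circle, expI_eq_circle, ← self_sub_toIcoDiv_zsmul, Circle.periodic_exp.sub_zsmul_eq]

theorem isQuantumPair_shift {u : ℂ} (hu : ‖u‖ = 1) : IsQuantumPair q (C hq * S) (u • d hq) := by
  have hu' : u * conj u = 1 := by rw [Complex.mul_conj, Complex.normSq_eq_norm_sq, hu]; simp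
  obtain ⟨φ, rfl⟩ : ∃ φ : ℝ, expI φ = u := exists_expI_eq u hu
  have k2 : star (expI φ • d hq) = conj (expI φ) • d hq := by rw [star_smul, star_d]; rfl
  have k3 : expI φ • d hq * star (expI φ • d hq) = d hq * d hq := by
    rw [k2, smul_mul_smul_comm, hu', one_smul]
  have hcc := sqrt_mul_self_cast hq
  -- These two relations involve only `z 0 1` and `z 1 1`, so the first angle is immaterial.
  refine ⟨rhoGen_rel hq 0 φ _ _ .h6, rhoGen_rel hq 0 φ _ _ .c4, ?_, ?_, ?_⟩
  · rw [k3, k2, smul_mul_smul_comm, mul_comm, hu', one_smul]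
  · rw [k3, star_mul, star_C]
    ext x n
    simp only [mul_coord, sub_coord, one_coord, C_apply, d_apply]
    cases n with
    | zero => simp
    | succ n =>
      rw [S_apply_succ, mul_coord, star_S_apply, C_apply]
      linear_combination x (n + 1) * hcc (n + 1)
  · rw [k3, star_mul, star_C]
    ext x n
    simp only [mul_coord, sub_coord, one_coord, smul_coord, d_apply, star_S_apply, C_apply,
      S_apply_succ]
    linear_combination x n * hcc (n + 1)

/-- The scalar must be `e^{i(φ₁+φ₂)}`: multiplied by the adjoint of `e^{iφ₂} d(q)` it has to give
`e^{iφ₁} d(q)`. -/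
theorem rho_eq_pairRep (φ₁ φ₂ : ℝ) : rho hq φ₁ φ₂ =
    pairRep hq (isQuantumPair_shift hq (norm_expI φ₂)) (norm_expI (φ₁ + φ₂)) := by
  obtain ⟨r11, r10, r01, r00⟩ := rho_z hq φ₁ φ₂
  refine PolMat2.starAlgHom_ext fun a α => ?_
  rw [pairRep_z]
  fin_cases a <;> fin_cases α
  · refine r00.trans ?_
    change _ = (-((q : ℂ)⁻¹ * expI (φ₁ + φ₂))) • star (C hq * S)
    rw [star_mul, star_C, neg_mul, mul_comm]
  · exact r01
  · refine r10.trans ?_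
    change _ = expI (φ₁ + φ₂) • star (expI φ₂ • d hq)
    rw [star_smul, star_d, smul_smul, expI_add, mul_assoc]
    change _ = (expI φ₁ * (expI φ₂ * conj (expI φ₂))) • d hq
    rw [expI_conj, mul_one]
  · exact r11

theorem rho_congr {φ₁ φ₂ ψ₁ ψ₂ : ℝ} (h₁ : expI φ₁ = expI ψ₁) (h₂ : expI φ₂ = expI ψ₂) :
    rho hq φ₁ φ₂ = rho hq ψ₁ ψ₂ := by
  obtain ⟨r11, r10, r01, r00⟩ := rho_z hq φ₁ φ₂
  obtain ⟨s11, s10, s01, s00⟩ := rho_z hq ψ₁ ψ₂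
  refine PolMat2.starAlgHom_ext fun a α => ?_
  fin_cases a <;> fin_cases α
  · exact r00.trans (by rw [expI_add, h₁, h₂, ← expI_add, ← s00]; rfl)
  · exact r01.trans (by rw [h₂, ← s01]; rfl)
  · exact r10.trans (by rw [h₁, ← s10]; rfl)
  · exact r11.trans s11.symm

/-- The angles enter the generators only as phases, which do not affect norms. This makes the
supremum in the theorem finite. -/
theorem exists_norm_rho_le (a : PolMat2 q) : ∃ M : ℝ, ∀ φ₁ φ₂ : ℝ, ‖rho hq φ₁ φ₂ a‖ ≤ M := by
  have gen : ∀ a α, ∃ M : ℝ, ∀ φ₁ φ₂ : ℝ, ‖rho hq φ₁ φ₂ (PolMat2.z q a α)‖ ≤ M := by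
    intro a α
    fin_cases a <;> fin_cases α
    · refine ⟨‖(q : ℂ)⁻¹‖ * ‖star S * C hq‖, fun φ₁ φ₂ => (congrArg norm (rho_z hq φ₁ φ₂).2.2.2).le.trans ?_⟩
      rw [norm_smul, norm_mul, norm_neg, norm_expI, one_mul]
    · refine ⟨‖d hq‖, fun φ₁ φ₂ => (congrArg norm (rho_z hq φ₁ φ₂).2.2.1).le.trans ?_⟩
      rw [norm_smul, norm_expI, one_mul]
    · refine ⟨‖d hq‖, fun φ₁ φ₂ => (congrArg norm (rho_z hq φ₁ φ₂).2.1).le.trans ?_⟩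
      rw [norm_smul, norm_expI, one_mul]
    · exact ⟨‖C hq * S‖, fun φ₁ φ₂ => (congrArg norm (rho_z hq φ₁ φ₂).1).le⟩
  induction a using PolMat2.induction with
  | algebraMap c =>
    refine ⟨‖algebraMap ℂ (ell2 →L[ℂ] ell2) c‖, fun φ₁ φ₂ => ?_⟩
    rw [AlgHomClass.commutes]
  | gen a α => exact gen a α
  | star_gen a α =>
    obtain ⟨M, hM⟩ := gen a α
    refine ⟨M, fun φ₁ φ₂ => ?_⟩
    rw [map_star]
    exact (norm_star _).le.trans (hM φ₁ φ₂)
  | mul a b ha hb =>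
    obtain ⟨M, hM⟩ := ha
    obtain ⟨N, hN⟩ := hb
    refine ⟨M * N, fun φ₁ φ₂ => ?_⟩
    rw [map_mul]
    exact (norm_mul_le _ _).trans (mul_le_mul (hM _ _) (hN _ _) (norm_nonneg _)
      ((norm_nonneg _).trans (hM φ₁ φ₂)))
  | add a b ha hb =>
    obtain ⟨M, hM⟩ := ha
    obtain ⟨N, hN⟩ := hb
    refine ⟨M + N, fun φ₁ φ₂ => ?_⟩
    rw [map_add]
    exact (norm_add_le _ _).trans (add_le_add (hM _ _) (hN _ _))

end ShiftPair

/-! ### The case `C = 0`: characters and unitary `A` -/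

section CommutativePart

variable {H : Type*} [NormedAddCommGroup H] [InnerProductSpace ℂ H] [CompleteSpace H]
  {q : ℝ} (hq : q ∈ Set.Ioo (0 : ℝ) 1)

theorem isQuantumPair_scalar (q : ℝ) (u : Circle) :
    IsQuantumPair q ((u : ℂ) • (1 : H →L[ℂ] H)) 0 := by
  have hu : (u : ℂ) * conj (u : ℂ) = 1 := by
    rw [Complex.mul_conj, Complex.normSq_eq_norm_sq, Circle.norm_coe]; simp
  constructor <;> simp [star_smul, smul_smul, hu]
  rw [mul_comm, hu, one_smul]

/-- The sign in `h₂` compensates the minus sign of `z 0 0` in `pairGen`, which `gamma` does not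
have. -/
theorem pairRep_scalar (u : Circle) {g : ℂ} (hg : ‖g‖ = 1) (φ₁ φ₂ : ℝ) (h₁ : expI φ₁ = u)
    (h₂ : g = -expI (φ₁ + φ₂)) (a : PolMat2 q) :
    pairRep hq (isQuantumPair_scalar (H := H) q u) hg a = gamma hq φ₁ φ₂ a • 1 := by
  obtain ⟨g11, g10, g01, g00⟩ := gamma_z hq φ₁ φ₂
  have gen : ∀ a α, pairRep hq (isQuantumPair_scalar (H := H) q u) hg (PolMat2.z q a α)
      = gamma hq φ₁ φ₂ (PolMat2.z q a α) • 1 := by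
    intro a α
    rw [pairRep_z]
    fin_cases a <;> fin_cases α
    · change (-((q : ℂ)⁻¹ * g)) • star ((u : ℂ) • (1 : H →L[ℂ] H)) = gamma hq φ₁ φ₂ (PolMat2.z q 0 0) • 1
      rw [g00, h₂, ← h₁, expI_add, star_smul, star_one, smul_smul]
      congr 1
      change _ * conj (expI φ₁) = _
      linear_combination (expI φ₂ * (q : ℂ)⁻¹) * expI_conj φ₁
    · change 0 = gamma hq φ₁ φ₂ (PolMat2.z q 0 1) • _
      rw [g01, zero_smul]
    · change g • star 0 = gamma hq φ₁ φ₂ (PolMat2.z q 1 0) • _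
      rw [g10, zero_smul, star_zero, smul_zero]
    · change (u : ℂ) • 1 = gamma hq φ₁ φ₂ (PolMat2.z q 1 1) • _
      rw [g11, h₁]
  induction a using PolMat2.induction with
  | algebraMap c =>
    rw [AlgHomClass.commutes, AlgHomClass.commutes, Algebra.algebraMap_eq_smul_one]; rfl
  | gen a α => exact gen a α
  | star_gen a α => rw [map_star, map_star, gen, star_smul, star_one]
  | mul a b ha hb => rw [map_mul, map_mul, ha, hb, smul_mul_smul_comm, one_mul]
  | add a b ha hb => rw [map_add, map_add, ha, hb, add_smul]

/-- The norm estimate for the representations in which `z 0 1` acts by zero. -/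
theorem norm_pairRep_le_of_zero {A : H →L[ℂ] H} (h : IsQuantumPair q A 0) {g : ℂ} (hg : ‖g‖ = 1)
    {a : PolMat2 q} {M : ℝ} (hM : ∀ φ₁ φ₂ : ℝ, ‖rho hq φ₁ φ₂ a‖ ≤ M) :
    ‖pairRep hq h hg a‖ ≤ M := by
  have h1 : star A * A = 1 := by simpa using h.star_mul
  have h2 : A * star A = 1 := by simpa using h.mul_star
  -- Here `A` itself is the unitary to be replaced by scalars; its fibres are multiples of the
  -- characters `gamma`.
  have hf : IsFiberedOver A (pairRep hq h hg a)
      fun u => pairRep hq (isQuantumPair_scalar (H := H) q u) hg a := by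
    have sA := IsFiberedOver.self A
    have sA' := IsFiberedOver.star_self h1 h2
    have s0 : IsFiberedOver A 0 (fun _ => 0) := IsFiberedOver.const (Commute.zero_left A)
    refine PolMat2.isFiberedOver (fun a α => ?_) (fun a α => ?_) a <;>
      simp only [pairRep_z] <;> fin_cases a <;> fin_cases α
    · exact (sA'.smul (-((q : ℂ)⁻¹ * g))).congr rfl fun u => by simp [pairGen, star_smul]
    · exact s0
    · exact s0.congr (by simp [pairGen]) fun u => by simp [pairGen]
    · exact sA
    · exact (sA.smul (conj (-((q : ℂ)⁻¹ * g)))).congr (by simp [pairGen, star_smul])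
        fun u => by simp [pairGen, star_smul]
    · exact s0.congr (by simp [pairGen]) fun u => by simp [pairGen]
    · exact s0.congr (by simp [pairGen]) fun u => by simp [pairGen]
    · exact sA'.congr (by simp [pairGen]) fun u => by simp [pairGen, star_smul]
  refine hf.opNorm_le (norm_apply_of_star_mul_self h1) fun u => ?_
  · obtain ⟨φ₁, h₁⟩ := exists_expI_eq u (Circle.norm_coe u)
    obtain ⟨φ, h₂⟩ := exists_expI_eq (-g) (by rwa [norm_neg])
    rw [pairRep_scalar hq u hg φ₁ (φ - φ₁) h₁ (by rw [add_sub_cancel, h₂, neg_neg])]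
    exact (IsFiberedOver.norm_smul_one_le _).trans ((norm_gamma_le hq _ _ a).trans (hM _ _))

end CommutativePart

/-! ### Restriction to reducing subspaces -/

section Restriction

variable {H : Type*} [NormedAddCommGroup H] [InnerProductSpace ℂ H]

/-- The restriction of an operator to an invariant subspace. -/
def restrictTo (K : Submodule ℂ H) (T : H →L[ℂ] H) (h : ∀ x ∈ K, T x ∈ K) : K →L[ℂ] K :=
  (T ∘L K.subtypeL).codRestrict K fun x => h x x.2

@[simp]
theorem coe_restrictTo (K : Submodule ℂ H) (T : H →L[ℂ] H) (h : ∀ x ∈ K, T x ∈ K) (x : K) :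
    (restrictTo K T h x : H) = T x := rfl

variable [CompleteSpace H]

theorem star_restrictTo (K : Submodule ℂ H) [CompleteSpace K] (T : H →L[ℂ] H)
    (h : ∀ x ∈ K, T x ∈ K) (h' : ∀ x ∈ K, star T x ∈ K) :
    star (restrictTo K T h) = restrictTo K (star T) h' := by
  symm
  refine (ContinuousLinearMap.eq_adjoint_iff _ _).2 ?_
  intro x y
  rw [Submodule.coe_inner, Submodule.coe_inner, coe_restrictTo, coe_restrictTo,
    ContinuousLinearMap.star_eq_adjoint, ContinuousLinearMap.adjoint_inner_left]

theorem IsQuantumPair.restrictTo {q : ℝ} {A C : H →L[ℂ] H} (h : IsQuantumPair q A C)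
    (K : Submodule ℂ H) [CompleteSpace K] (hA : ∀ x ∈ K, A x ∈ K) (hA' : ∀ x ∈ K, star A x ∈ K)
    (hC : ∀ x ∈ K, C x ∈ K) (hC' : ∀ x ∈ K, star C x ∈ K) :
    IsQuantumPair q (restrictTo K A hA) (restrictTo K C hC) := by
  constructor <;> ext x <;> simp only [star_restrictTo K A hA hA', star_restrictTo K C hC hC',
    mul_apply_eq_comp, _root_.smul_apply, _root_.sub_apply, one_apply_eq_self, Submodule.coe_smul,
    AddSubgroupClass.coe_sub, coe_restrictTo]
  · simpa using congrArg (fun T : H →L[ℂ] H => T x) h.comm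
  · simpa using congrArg (fun T : H →L[ℂ] H => T x) h.star_comm
  · simpa using congrArg (fun T : H →L[ℂ] H => T x) h.normal
  · simpa using congrArg (fun T : H →L[ℂ] H => T x) h.mul_star
  · simpa using congrArg (fun T : H →L[ℂ] H => T x) h.star_mul

theorem orthogonal_invariant {K : Submodule ℂ H} {T : H →L[ℂ] H} (h : ∀ x ∈ K, star T x ∈ K) :
    ∀ x ∈ Kᗮ, T x ∈ Kᗮ := by
  intro x hx y hy
  rw [← ContinuousLinearMap.adjoint_inner_left, ← ContinuousLinearMap.star_eq_adjoint]
  exact hx _ (h y hy)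

end Restriction

/-! ### Ladder vectors and the orthogonal complement of their span -/

section Ladder

variable {H : Type*} [NormedAddCommGroup H] [InnerProductSpace ℂ H]

/-- Operators on `ell2` are determined by their values on the basis vectors. -/
theorem ext_on_e {T T' : ell2 →L[ℂ] H} (h : ∀ n, T (e n) = T' (e n)) : T = T' := by
  ext x
  have hx := lp.hasSum_single (E := fun _ : ℕ => ℂ) (p := 2) (by norm_num) x
  have he : ∀ n, (lp.single 2 n (x n) : ell2) = x n • e n := by
    intro n
    rw [e, ← lp.single_smul, smul_eq_mul, mul_one]
  simp only [he] at hx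
  refine (hx.mapL T).unique ?_
  convert hx.mapL T' using 2 with n
  rw [map_smul, map_smul, h]

variable [CompleteSpace H]

/-- The orthogonal complement of the range is the kernel of the adjoint, here of `X` itself. Density
permits right cancellation of `X` in operator identities. -/
theorem denseRange_of_injective {X : H →L[ℂ] H} (hs : star X = X) (hX : ∀ x, X x = 0 → x = 0) :
    DenseRange X := by
  have h1 : X.rangeᗮ = ⊥ := by
    rw [X.orthogonal_range, ← ContinuousLinearMap.star_eq_adjoint, hs, eq_bot_iff]
    exact fun x hx => hX x hx
  have h2 := Submodule.topologicalClosure_eq_top_iff.2 h1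
  have h3 := Submodule.dense_iff_topologicalClosure_eq_top.2 h2
  exact h3

omit [CompleteSpace H] in
theorem mul_right_cancel_of_denseRange {X T T' : H →L[ℂ] H} (hX : DenseRange X)
    (h : T * X = T' * X) : T = T' := by
  have := hX.equalizer T.continuous T'.continuous
    (funext fun x => congrArg (fun U : H →L[ℂ] H => U x) h)
  exact DFunLike.coe_injective this

namespace IsHilbertSum

variable {ι G : Type*} [NormedAddCommGroup G] [InnerProductSpace ℂ G]
  {W : ι → G →ₗᵢ[ℂ] H}

theorem exists_hasSum (hW : IsHilbertSum ℂ (fun _ => G) W) (x : H) :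
    ∃ y : ι → G, HasSum (fun i => W i (y i)) x := by
  obtain ⟨y, rfl⟩ := hW.surjective_isometry x
  exact ⟨y, hW.OrthogonalFamily.hasSum_linearIsometry y⟩

theorem operator_ext (hW : IsHilbertSum ℂ (fun _ => G) W) {T T' : H →L[ℂ] H}
    (h : ∀ i x, T (W i x) = T' (W i x)) : T = T' := by
  ext x
  obtain ⟨y, hy⟩ := exists_hasSum hW x
  refine (hy.mapL T).unique ?_
  simpa only [h] using hy.mapL T'

/-- The norm of an operator that acts diagonally on a Hilbert sum. -/
theorem opNorm_le (hW : IsHilbertSum ℂ (fun _ => G) W) {T : H →L[ℂ] H} {R : G →L[ℂ] G}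
    (h : ∀ i x, W i (R x) = T (W i x)) : ‖T‖ ≤ ‖R‖ := by
  refine ContinuousLinearMap.opNorm_le_bound _ (norm_nonneg _) fun x => ?_
  obtain ⟨y, hy⟩ := exists_hasSum hW x
  have hT := hy.mapL T
  refine le_of_tendsto_of_tendsto' hT.norm ((hy.norm).const_mul ‖R‖) fun s => ?_
  refine le_of_sq_le_sq ?_ (by positivity)
  have h1 : ∀ i, T (W i (y i)) = W i (R (y i)) := fun i => (h i _).symm
  simp only [h1]
  rw [mul_pow, hW.OrthogonalFamily.norm_sum (fun i => R (y i)) s,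
    hW.OrthogonalFamily.norm_sum y s, Finset.mul_sum]
  refine Finset.sum_le_sum fun i _ => ?_
  rw [← mul_pow]
  exact pow_le_pow_left₀ (norm_nonneg _) (R.le_opNorm _) 2

end IsHilbertSum

/-- The weight `√(1 - q ^ (2 n))` of the weighted shift `C * S`. -/
noncomputable def shiftWeight (q : ℝ) (n : ℕ) : ℂ := ((√(1 - q ^ (2 * n)) : ℝ) : ℂ)

theorem shiftWeight_ne_zero {q : ℝ} (hq : q ∈ Set.Ioo (0 : ℝ) 1) (n : ℕ) :
    shiftWeight q (n + 1) ≠ 0 := by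
  have h : q ^ (2 * (n + 1)) < 1 := pow_lt_one₀ hq.1.le hq.2 (by omega)
  exact Complex.ofReal_ne_zero.2 (Real.sqrt_pos.2 (by linarith)).ne'

/-- The operators mapping the kernel of `star A` to the successive eigenspaces of
`C * star C`. -/
noncomputable def ladder (q : ℝ) (A : H →L[ℂ] H) : ℕ → H →L[ℂ] H
  | 0 => 1
  | n + 1 => (shiftWeight q (n + 1))⁻¹ • (A * ladder q A n)

namespace IsQuantumPair

variable {q : ℝ} (hq : q ∈ Set.Ioo (0 : ℝ) 1) {A C : H →L[ℂ] H}

omit [CompleteSpace H] in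
include hq in
theorem apply_ladder (n : ℕ) (x : H) :
    A (ladder q A n x) = shiftWeight q (n + 1) • ladder q A (n + 1) x := by
  rw [ladder, _root_.smul_apply, smul_smul, mul_inv_cancel₀ (shiftWeight_ne_zero hq n), one_smul]
  rfl

variable (h : IsQuantumPair q A C)
include h

theorem mul_normal : C * star C * A = (q : ℂ) ^ 2 • (A * (C * star C)) := by
  rw [mul_assoc, h.comm_star, mul_smul_comm, ← mul_assoc, h.comm, smul_mul_assoc, smul_smul,
    mul_assoc, pow_two]

/-- On the kernel of `A*` the relation `A A* = 1 - C C*` forces `C C* = 1`, and each application of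
`A` multiplies the eigenvalue by `q²`. -/
theorem normal_ladder {x : H} (hx : star A x = 0) (n : ℕ) :
    C (star C (ladder q A n x)) = ((q : ℂ) ^ n) ^ 2 • ladder q A n x := by
  induction n with
  | zero =>
    have := congrArg (fun T : H →L[ℂ] H => T x) h.mul_star
    simp only [mul_apply_eq_comp, hx, map_zero, _root_.sub_apply, one_apply_eq_self] at this
    simp only [ladder, one_apply_eq_self, pow_zero, one_pow, one_smul]
    exact (sub_eq_zero.1 this.symm).symm
  | succ n ih =>
    have := congrArg (fun T : H →L[ℂ] H => T (ladder q A n x)) h.mul_normal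
    simp only [mul_apply_eq_comp, _root_.smul_apply, ih, map_smul, smul_smul] at this
    simp only [ladder, _root_.smul_apply, mul_apply_eq_comp, map_smul, this, smul_smul]
    congr 1
    ring

-- The eigenvalue of `A* A = 1 - q² C C*` on the `n`-th rung is the square of the weight with index
-- `n + 1`; this dictates the normalisation of `ladder`.
include hq in
theorem star_apply_ladder {x : H} (hx : star A x = 0) (n : ℕ) :
    star A (ladder q A (n + 1) x) = shiftWeight q (n + 1) • ladder q A n x := by
  have := congrArg (fun T : H →L[ℂ] H => T (ladder q A n x)) h.star_mul
  simp only [mul_apply_eq_comp, _root_.sub_apply, one_apply_eq_self, _root_.smul_apply,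
    h.normal_ladder hx] at this
  have hc : shiftWeight q (n + 1) * shiftWeight q (n + 1) = 1 - ((q : ℂ) ^ (n + 1)) ^ 2 :=
    sqrt_mul_self_cast hq (n + 1)
  have h0 := shiftWeight_ne_zero hq n
  have hw : ladder q A n x - (q : ℂ) ^ 2 • ((q : ℂ) ^ n) ^ 2 • ladder q A n x
      = (shiftWeight q (n + 1) * shiftWeight q (n + 1)) • ladder q A n x := by
    rw [hc]
    module
  rw [ladder, _root_.smul_apply, map_smul, mul_apply_eq_comp, this, hw, smul_smul,
    inv_mul_cancel_left₀ h0]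

-- Moving `A` across the inner product lowers both indices by one, until one side lies in the kernel
-- of `A*`.
include hq in
theorem inner_ladder {x y : H} (hx : star A x = 0) (hy : star A y = 0) (m n : ℕ) :
    inner ℂ (ladder q A m x) (ladder q A n y) = if m = n then inner ℂ x y else 0 := by
  have hadj : ∀ u v : H, inner ℂ (A u) v = inner ℂ u (star A v) := fun u v => by
    rw [ContinuousLinearMap.star_eq_adjoint, ContinuousLinearMap.adjoint_inner_right]
  have hadj' : ∀ u v : H, inner ℂ u (A v) = inner ℂ (star A u) v := fun u v => by
    rw [ContinuousLinearMap.star_eq_adjoint, ContinuousLinearMap.adjoint_inner_left]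
  induction m generalizing n with
  | zero =>
    cases n with
    | zero => simp [ladder]
    | succ n => simp [ladder, hadj', hx]
  | succ m ih =>
    cases n with
    | zero => simp [ladder, hadj, hy]
    | succ n =>
      have h0 := shiftWeight_ne_zero hq n
      rw [ladder, _root_.smul_apply, mul_apply_eq_comp, inner_smul_left, hadj,
        h.star_apply_ladder hq hy, inner_smul_right, ih]
      simp only [Nat.add_right_cancel_iff]
      split_ifs with hmn
      · subst hmn
        have hr : conj (shiftWeight q (m + 1)) = shiftWeight q (m + 1) := Complex.conj_ofReal _
        rw [map_inv₀, hr, inv_mul_cancel_left₀ h0]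
      · simp

end IsQuantumPair

theorem norm_sq_apply_eq_inner (T : H →L[ℂ] H) (x : H) :
    ((‖T x‖ ^ 2 : ℝ) : ℂ) = inner ℂ (star T (T x)) x := by
  rw [ContinuousLinearMap.star_eq_adjoint, ContinuousLinearMap.adjoint_inner_left,
    inner_self_eq_norm_sq_to_K]
  simp

namespace IsQuantumPair

variable {q : ℝ} {A C : H →L[ℂ] H} (h : IsQuantumPair q A C)
include h

theorem norm_star_apply (x : H) : ‖star C x‖ = ‖C x‖ := by
  have h1 := norm_sq_apply_eq_inner C x
  have h2 := norm_sq_apply_eq_inner (star C) x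
  rw [star_star, ← mul_apply_eq_comp, ← h.normal, mul_apply_eq_comp, ← h1] at h2
  exact (sq_eq_sq₀ (norm_nonneg _) (norm_nonneg _)).1 (Complex.ofReal_injective h2)

theorem norm_sq_right (x : H) : ‖A x‖ ^ 2 = ‖x‖ ^ 2 - q ^ 2 * ‖C x‖ ^ 2 := by
  have h1 := norm_sq_apply_eq_inner C x
  have h2 := norm_sq_apply_eq_inner A x
  rw [← mul_apply_eq_comp, h.star_mul, ← h.normal, _root_.sub_apply, inner_sub_left,
    _root_.smul_apply, inner_smul_left, mul_apply_eq_comp, ← h1, one_apply_eq_self,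
    inner_self_eq_norm_sq_to_K] at h2
  apply Complex.ofReal_injective
  rw [h2]
  simp

theorem norm_sq_left (x : H) : ‖star A x‖ ^ 2 = ‖x‖ ^ 2 - ‖C x‖ ^ 2 := by
  have h1 := norm_sq_apply_eq_inner C x
  have h2 := norm_sq_apply_eq_inner (star A) x
  rw [star_star, ← mul_apply_eq_comp, h.mul_star, ← h.normal, _root_.sub_apply, inner_sub_left,
    mul_apply_eq_comp, ← h1, one_apply_eq_self, inner_self_eq_norm_sq_to_K] at h2
  apply Complex.ofReal_injective
  rw [h2]
  simp

theorem norm_apply_le (x : H) : ‖C x‖ ≤ ‖x‖ := by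
  have := h.norm_sq_left x
  refine le_of_sq_le_sq ?_ (norm_nonneg _)
  nlinarith [sq_nonneg ‖star A x‖]

variable (hq : q ∈ Set.Ioo (0 : ℝ) 1)
include hq

/-- `A` is bounded below: `‖A x‖² = ‖x‖² - q² ‖C x‖² ≥ (1 - q²) ‖x‖²`. -/
theorem isClosed_range : IsClosed (Set.range A) := by
  have hq2 : 0 < 1 - q ^ 2 := by nlinarith [hq.1, hq.2]
  have hb : ∀ x, ‖x‖ ≤ (√(1 - q ^ 2))⁻¹ * ‖A x‖ := by
    intro x
    have h1 := h.norm_sq_right x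
    have h2 := pow_le_pow_left₀ (norm_nonneg _) (h.norm_apply_le x) 2
    rw [inv_mul_eq_div, le_div_iff₀ (Real.sqrt_pos.2 hq2)]
    refine le_of_sq_le_sq ?_ (norm_nonneg _)
    rw [mul_pow, Real.sq_sqrt hq2.le, h1]
    nlinarith [sq_nonneg q]
  have ha : AntilipschitzWith (Real.toNNReal (√(1 - q ^ 2))⁻¹) A :=
    AddMonoidHomClass.antilipschitz_of_bound A fun x => by
      rw [Real.coe_toNNReal _ (by positivity)]; exact hb x
  exact ha.isClosed_range A.uniformContinuous

/-- On the range of `A ^ n` the operator `C` is at most `q ^ n`. One factor `q` per step comes from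
`C A = q A C`; what remains is `‖A (C z)‖ ≤ q ^ n * ‖A z‖`. -/
theorem norm_apply_pow_le (n : ℕ) (x : H) : ‖C ((A ^ n) x)‖ ≤ q ^ n * ‖(A ^ n) x‖ := by
  induction n with
  | zero => simpa using h.norm_apply_le x
  | succ n ih =>
    rw [pow_succ', mul_apply_eq_comp]
    generalize (A ^ n) x = z at ih ⊢
    have e1 : C (A z) = (q : ℂ) • A (C z) := congrArg (fun T : H →L[ℂ] H => T z) h.comm
    have e2 := h.norm_sq_right z
    have e3 := h.norm_sq_right (C z)
    have e4 : ‖C z‖ ^ 2 ≤ ‖C (C z)‖ * ‖z‖ := by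
      have h1 := norm_sq_apply_eq_inner C z
      have h2 := norm_inner_le_norm (𝕜 := ℂ) (star C (C z)) z
      rw [← h1, h.norm_star_apply, Complex.norm_real, Real.norm_eq_abs, abs_of_nonneg (sq_nonneg _)]
        at h2
      exact h2
    have ht : 0 < q ^ n := pow_pos hq.1 n
    rw [e1, norm_smul, Complex.norm_real, Real.norm_eq_abs, abs_of_pos hq.1, pow_succ', mul_assoc]
    refine mul_le_mul_of_nonneg_left ?_ hq.1.le
    refine le_of_sq_le_sq ?_ (by positivity)
    rw [mul_pow, e3, e2]
    have n1 : 0 ≤ ‖z‖ ^ 2 - q ^ 2 * ‖C z‖ ^ 2 := by rw [← e2]; positivity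
    have n2 := norm_nonneg z
    have n3 := norm_nonneg (C z)
    have n4 := norm_nonneg (C (C z))
    generalize ‖z‖ = a at *
    generalize ‖C z‖ = b at *
    generalize ‖C (C z)‖ = c at *
    generalize q ^ n = t at *
    clear e1 e2 e3
    rcases n2.eq_or_lt with ha | ha
    · subst ha
      have hb : b = 0 := by nlinarith
      subst hb
      nlinarith [mul_nonneg (sq_nonneg q) (sq_nonneg c)]
    -- After multiplication by `a²`, Cauchy–Schwarz `b² ≤ c a` gives `a² (b² - q² c²) ≤ b² (a² - q²
    -- b²)`, and `b ≤ t a` bounds this by `t² a² (a² - q² b²)`.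
    · have h1 : b ^ 2 ≤ t ^ 2 * a ^ 2 := by
        rw [← mul_pow]; exact pow_le_pow_left₀ n3 ih 2
      have h2 : (b ^ 2) ^ 2 ≤ (c * a) ^ 2 := pow_le_pow_left₀ (sq_nonneg b) e4 2
      have h3 := mul_le_mul_of_nonneg_right h1 n1
      have h4 := mul_le_mul_of_nonneg_left h2 (sq_nonneg q)
      have ha2 : 0 < a ^ 2 := by positivity
      refine le_of_mul_le_mul_left ?_ ha2
      nlinarith

/-- A vector orthogonal to all `ladder q A n x` with `star A x = 0` is annihilated by `C`. -/
theorem apply_eq_zero_of_orthogonal {x : H}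
    (hx : ∀ y, star A y = 0 → ∀ n, inner ℂ (ladder q A n y) x = 0) : C x = 0 := by
  -- Orthogonality to the kernel of `A*` puts `x` in the closed range of `A`, and since `A*` lowers
  -- the ladder, the preimage is again orthogonal to it. Iteration puts `x` in the range of every `A
  -- ^ n`.
  have step : ∀ x : H, (∀ y, star A y = 0 → ∀ n, inner ℂ (ladder q A n y) x = 0) →
      ∃ x', x = A x' ∧ ∀ y, star A y = 0 → ∀ n, inner ℂ (ladder q A n y) x' = 0 := by
    intro x hx
    have hmem : x ∈ A.range := by
      have hc : A.range.topologicalClosure = A.range :=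
        IsClosed.submodule_topologicalClosure_eq (h.isClosed_range hq)
      have := (star A).orthogonal_ker
      rw [← ContinuousLinearMap.star_eq_adjoint, star_star, hc] at this
      rw [← this]
      intro y hy
      simpa [ladder] using hx y hy 0
    obtain ⟨x', rfl⟩ := hmem
    refine ⟨x', rfl, fun y hy n => ?_⟩
    have h1 := hx y hy (n + 1)
    have h2 : inner ℂ (ladder q A (n + 1) y) (A x')
        = inner ℂ (star A (ladder q A (n + 1) y)) x' := by
      rw [ContinuousLinearMap.star_eq_adjoint, ContinuousLinearMap.adjoint_inner_left]
    have h3 : inner ℂ (ladder q A (n + 1) y) (A x') = 0 := h1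
    rw [h2, h.star_apply_ladder hq hy, inner_smul_left] at h3
    exact (mul_eq_zero.1 h3).resolve_left (by simpa using shiftWeight_ne_zero hq n)
  have pow : ∀ n, ∃ x', x = (A ^ n) x' ∧ ∀ y, star A y = 0 → ∀ n, inner ℂ (ladder q A n y) x' = 0 := by
    intro n
    induction n with
    | zero => exact ⟨x, rfl, hx⟩
    | succ n ih =>
      obtain ⟨y, hy, hy'⟩ := ih
      obtain ⟨z, rfl, hz⟩ := step y hy'
      exact ⟨z, hy.trans (by rw [pow_succ]; rfl), hz⟩
  have bound : ∀ n : ℕ, ‖C x‖ ≤ q ^ n * ‖x‖ := by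
    intro n
    obtain ⟨y, hy, -⟩ := pow n
    rw [hy]
    exact h.norm_apply_pow_le hq n y
  have lim : Tendsto (fun n : ℕ => q ^ n * ‖x‖) atTop (𝓝 (0 * ‖x‖)) :=
    (tendsto_pow_atTop_nhds_zero_of_lt_one hq.1.le hq.2).mul_const _
  rw [zero_mul] at lim
  exact norm_le_zero_iff.1 (ge_of_tendsto' lim bound)

end IsQuantumPair
end Ladder

universe u

/-! ### Decomposition into weighted shifts, and the polar decomposition -/

section Decomposition

variable {H : Type u} [NormedAddCommGroup H] [InnerProductSpace ℂ H] [CompleteSpace H]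

namespace IsQuantumPair

variable {q : ℝ} {A C : H →L[ℂ] H} (h : IsQuantumPair q A C) (hq : q ∈ Set.Ioo (0 : ℝ) 1)
include h hq

theorem orthonormal_ladder {x : H} (hx : star A x = 0) (h1 : ‖x‖ = 1) :
    Orthonormal ℂ fun n => ladder q A n x := by
  rw [orthonormal_iff_ite]
  intro m n
  rw [h.inner_ladder hq hx hx, inner_self_eq_norm_sq_to_K, h1]
  simp

/-- If `C` is injective, the Hilbert space is a sum of copies of `ell2` on which `A` acts as the
weighted shift and `C` has the modulus `d`. -/
theorem exists_isHilbertSum (hinj : ∀ x, C x = 0 → x = 0) :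
    ∃ (ι : Type u) (W : ι → ell2 →ₗᵢ[ℂ] H), IsHilbertSum ℂ (fun _ => ell2) W ∧
      (∀ i x, W i ((QuantumBall.C hq * S) x) = A (W i x)) ∧
      (∀ i x, W i (star (QuantumBall.C hq * S) x) = star A (W i x)) ∧
      ∀ i n, C (star C (W i (e n))) = ((q : ℂ) ^ n) ^ 2 • W i (e n) := by
  -- Each vector of an orthonormal basis of the kernel of `A*` generates one copy of `ell2`.
  obtain ⟨ι, b, -⟩ := exists_hilbertBasis ℂ (star A).ker
  have hker : ∀ i, star A (b i : H) = 0 := fun i => (b i).2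
  have hnorm : ∀ i, ‖(b i : H)‖ = 1 := fun i => b.orthonormal.1 i
  let hO := fun i => (h.orthonormal_ladder hq (hker i) (hnorm i)).orthogonalFamily
  let W : ι → ell2 →ₗᵢ[ℂ] H := fun i => (hO i).linearIsometry
  have hWe : ∀ i n, W i (e n) = ladder q A n (b i) := by
    intro i n
    have := (hO i).linearIsometry_apply_single (i := n) (1 : ℂ)
    refine this.trans ?_
    simp
  have hWA : ∀ i x, W i ((QuantumBall.C hq * S) x) = A (W i x) := by
    intro i x
    have : (W i).toContinuousLinearMap ∘L (QuantumBall.C hq * S)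
        = A ∘L (W i).toContinuousLinearMap := by
      refine ext_on_e fun n => ?_
      change W i (QuantumBall.C hq (S (e n))) = A (W i (e n))
      rw [S_e, C_e, map_smul, hWe, hWe, apply_ladder hq]
      rfl
    exact congrArg (fun T : ell2 →L[ℂ] H => T x) this
  have hWA' : ∀ i x, W i (star (QuantumBall.C hq * S) x) = star A (W i x) := by
    intro i x
    have : (W i).toContinuousLinearMap ∘L (star (QuantumBall.C hq * S))
        = star A ∘L (W i).toContinuousLinearMap := by
      refine ext_on_e fun n => ?_
      change W i (star (QuantumBall.C hq * S) (e n)) = star A (W i (e n))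
      rw [StarMul.star_mul, star_C, mul_apply_eq_comp, C_e, map_smul, map_smul, hWe]
      cases n with
      | zero => simp [ladder, hker]
      | succ n =>
        have hs : star S (e (n + 1)) = e n := by
          rw [← S_e, ← mul_apply_eq_comp, star_S_mul_S]; rfl
        rw [hs, hWe, h.star_apply_ladder hq (hker i)]
        rfl
    exact congrArg (fun T : ell2 →L[ℂ] H => T x) this
  have horth : OrthogonalFamily ℂ (fun _ : ι => ell2) W := by
    intro i j hij x y
    have h1 : ∀ m, ∀ y, inner ℂ (W i (e m)) (W j y) = 0 := by
      intro m y
      have : (innerSL ℂ (W i (e m))) ∘L (W j).toContinuousLinearMap = 0 := by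
        refine ext_on_e fun n => ?_
        change inner ℂ (W i (e m)) (W j (e n)) = 0
        rw [hWe, hWe, h.inner_ladder hq (hker i) (hker j)]
        have : inner ℂ (b i : H) (b j : H) = 0 := b.orthonormal.2 hij
        simp [this]
      exact congrArg (fun T : ell2 →L[ℂ] ℂ => T y) this
    have h2 : (innerSL ℂ (W j y)) ∘L (W i).toContinuousLinearMap = 0 := by
      refine ext_on_e fun m => ?_
      change inner ℂ (W j y) (W i (e m)) = 0
      rw [← inner_conj_symm, h1, map_zero]
    have h3 : inner ℂ (W j y) (W i x) = 0 := congrArg (fun T : ell2 →L[ℂ] ℂ => T x) h2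
    rw [← inner_conj_symm, h3, map_zero]
  refine ⟨ι, W, IsHilbertSum.mk horth ?_, hWA, hWA', fun i n => ?_⟩
  -- Completeness: a vector orthogonal to all copies is orthogonal to the ladders over the whole
  -- kernel of `A*`, by density of the span of the basis. Hence `C` annihilates it, and it is zero.
  · rw [top_le_iff, Submodule.topologicalClosure_eq_top_iff, eq_bot_iff]
    intro x hx
    refine hinj x (h.apply_eq_zero_of_orthogonal hq fun y hy n => ?_)
    have h0 : ∀ i, inner ℂ (ladder q A n (b i)) x = 0 := by
      intro i
      rw [← hWe]
      refine hx _ ?_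
      exact Submodule.mem_iSup_of_mem i ⟨e n, rfl⟩
    have h1 : (innerSL ℂ x) ∘L (ladder q A n) ∘L (star A).ker.subtypeL = 0 := by
      refine ContinuousLinearMap.ext_on
        (Submodule.dense_iff_topologicalClosure_eq_top.2 b.dense_span) ?_
      rintro _ ⟨i, rfl⟩
      change inner ℂ x (ladder q A n (b i)) = 0
      rw [← inner_conj_symm, h0, map_zero]
    have h2 : inner ℂ x (ladder q A n y) = 0 :=
      congrArg (fun T : (star A).ker →L[ℂ] ℂ => T ⟨y, hy⟩) h1
    rw [← inner_conj_symm, h2, map_zero]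
  · rw [hWe, h.normal_ladder (hker i)]

end IsQuantumPair

-- The vector `y = X x - t x` satisfies `X y = -t y`, which positivity of `X` allows only for `y =
-- 0`.
omit [CompleteSpace H] in
theorem apply_eq_smul_of_sq {X : H →L[ℂ] H} (hX : 0 ≤ X) {t : ℝ} (ht : 0 < t) {x : H}
    (h : X (X x) = ((t : ℂ) ^ 2) • x) : X x = (t : ℂ) • x := by
  have hp := (ContinuousLinearMap.nonneg_iff_isPositive X).1 hX
  set y := X x - (t : ℂ) • x with hy
  have h1 : X y = -((t : ℂ) • y) := by
    rw [hy, map_sub, map_smul, h]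
    module
  have h2 := hp.re_inner_nonneg_left y
  rw [h1, inner_neg_left, inner_smul_left, Complex.conj_ofReal, inner_self_eq_norm_sq_to_K] at h2
  have h3 : ‖y‖ = 0 := by
    have : t * ‖y‖ ^ 2 ≤ 0 := by
      have e1 : RCLike.re (-((t : ℂ) * ((‖y‖ : ℂ)) ^ 2)) = -(t * ‖y‖ ^ 2) := by
        rw [← Complex.ofReal_pow, ← Complex.ofReal_mul, ← Complex.ofReal_neg]
        rfl
      have e2 : 0 ≤ RCLike.re (-((t : ℂ) * ((‖y‖ : ℂ)) ^ 2)) := h2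
      rw [e1] at e2
      linarith
    have : ‖y‖ ^ 2 = 0 := le_antisymm (by nlinarith [sq_nonneg ‖y‖]) (sq_nonneg _)
    exact pow_eq_zero_iff (two_ne_zero) |>.1 this
  exact sub_eq_zero.1 (norm_eq_zero.1 h3)

/-- The polar decomposition of an injective normal operator. -/
theorem exists_polar {C X : H →L[ℂ] H} (hX : star X = X) (hXX : X * X = star C * C)
    (hinj : ∀ x, X x = 0 → x = 0) : ∃ U : H →L[ℂ] H, U * X = C ∧ star U * U = 1 := by
  have hd := denseRange_of_injective hX hinj
  have hn : ∀ x, ‖C x‖ = ‖X x‖ := by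
    intro x
    have h1 := norm_sq_apply_eq_inner C x
    have h2 := norm_sq_apply_eq_inner X x
    rw [hX, ← mul_apply_eq_comp, hXX, mul_apply_eq_comp, ← h1] at h2
    exact ((sq_eq_sq₀ (norm_nonneg _) (norm_nonneg _)).1 (Complex.ofReal_injective h2)).symm
  -- Since `‖C x‖ = ‖X x‖`, the assignment `X x ↦ C x` extends from the dense range of `X`.
  let U : H →L[ℂ] H := (C : H →ₗ[ℂ] H).extendOfNorm (X : H →ₗ[ℂ] H)
  have hU : U * X = C := by
    ext x
    exact LinearMap.extendOfNorm_eq (f := (C : H →ₗ[ℂ] H)) (e := (X : H →ₗ[ℂ] H)) hd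
      ⟨1, fun x => by rw [one_mul]; exact (hn x).le⟩ x
  refine ⟨U, hU, mul_right_cancel_of_denseRange hd ?_⟩
  -- Both sides are `C* C`; `X` cancels on the right by density and on the left by injectivity.
  have h1 : X * (star U * U * X) = X * (1 * X) := by
    rw [one_mul, hXX, ← hU, star_mul, hX]
    simp only [mul_assoc]
  ext x
  have h2 := congrArg (fun T : H →L[ℂ] H => T x) h1
  simp only [mul_apply_eq_comp X] at h2
  rw [← sub_eq_zero, ← map_sub] at h2
  exact sub_eq_zero.1 (hinj _ h2)

end Decomposition

/-! ### The norm estimates -/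

section NormBound

variable {H : Type*} [NormedAddCommGroup H] [InnerProductSpace ℂ H] [CompleteSpace H]
  {q : ℝ} (hq : q ∈ Set.Ioo (0 : ℝ) 1)

theorem pairRep_shift_eq_rho {u g : ℂ} (hu : ‖u‖ = 1) (hg : ‖g‖ = 1) : ∃ φ₁ φ₂ : ℝ,
    pairRep hq (isQuantumPair_shift hq hu) hg = rho hq φ₁ φ₂ := by
  obtain ⟨φ₂, rfl⟩ := exists_expI_eq u hu
  obtain ⟨φ, rfl⟩ := exists_expI_eq g hg
  refine ⟨φ - φ₂, φ₂, ?_⟩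
  rw [rho_eq_pairRep]
  simp only [sub_add_cancel]

/-- The norm estimate for the representations in which `z 0 1` acts injectively. -/
theorem norm_pairRep_le_of_injective {A C : H →L[ℂ] H} (h : IsQuantumPair q A C)
    (hinj : ∀ x, C x = 0 → x = 0) {g : ℂ} (hg : ‖g‖ = 1) {a : PolMat2 q} {M : ℝ}
    (hM : ∀ φ₁ φ₂ : ℝ, ‖rho hq φ₁ φ₂ a‖ ≤ M) : ‖pairRep hq h hg a‖ ≤ M := by
  have hnormal : IsStarNormal C := ⟨h.normal⟩
  obtain ⟨X, hX⟩ : ∃ X, X = CFC.abs C := ⟨_, rfl⟩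
  have hX0 : 0 ≤ X := hX ▸ CFC.abs_nonneg C
  have hXs : star X = X := (IsSelfAdjoint.of_nonneg hX0).star_eq
  have hXX : X * X = star C * C := by rw [hX]; exact CFC.abs_mul_abs C
  have hXC : X * C = C * X := by rw [hX]; exact (CFC.commute_abs_self C).eq
  have hXC' : star C * X = X * star C := by simpa [hXs] using congrArg star hXC
  have hXinj : ∀ x, X x = 0 → x = 0 := by
    intro x hx
    apply hinj
    have h1 : star C (C x) = 0 := by
      rw [← mul_apply_eq_comp, ← hXX, mul_apply_eq_comp, hx, map_zero]
    have h2 := norm_sq_apply_eq_inner C x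
    rw [h1, inner_zero_left] at h2
    simpa using h2
  have hd := denseRange_of_injective hXs hXinj
  obtain ⟨ι, W, hW, hWA, hWA', hWN⟩ := h.exists_isHilbertSum hq hinj
  have hWX : ∀ i x, W i (d hq x) = X (W i x) := by
    intro i x
    have : (W i).toContinuousLinearMap ∘L d hq = X ∘L (W i).toContinuousLinearMap := by
      refine ext_on_e fun n => ?_
      change W i (d hq (e n)) = X (W i (e n))
      have h1 : X (X (W i (e n))) = (((q ^ n : ℝ) : ℂ) ^ 2) • W i (e n) := by
        rw [← mul_apply_eq_comp, hXX, h.normal, mul_apply_eq_comp, hWN]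
        push_cast; rfl
      rw [apply_eq_smul_of_sq hX0 (pow_pos hq.1 n) h1, d_e, map_smul]
      push_cast; rfl
    exact congrArg (fun T : ell2 →L[ℂ] H => T x) this
  -- The relations of the pair give the squared form `X² A = q² A X²`; the relation for `X` itself
  -- is read off in each copy of `ell2`, where it is the one between `d(q)` and the weighted shift.
  have hXA : X * A = (q : ℂ) • (A * X) := by
    refine IsHilbertSum.operator_ext hW fun i x => ?_
    have h1 := (isQuantumPair_shift hq (u := 1) norm_one).comm
    rw [one_smul] at h1
    have h2 := congrArg (fun T : ell2 →L[ℂ] ell2 => W i (T x)) h1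
    simp only [_root_.smul_apply, map_smul] at h2
    rw [mul_apply_eq_comp, hWX, hWA] at h2
    rw [mul_apply_eq_comp, _root_.smul_apply, mul_apply_eq_comp, ← hWX i x, ← hWA i (d hq x)]
    exact h2
  have hAX : star A * X = (q : ℂ) • (X * star A) := by
    simpa [hXs, star_smul] using congrArg star hXA
  obtain ⟨U, hU, hUU⟩ := exists_polar hXs hXX hXinj
  have hq0 : (q : ℂ) ≠ 0 := by exact_mod_cast hq.1.ne'
  have cX : X * U = U * X := by
    refine mul_right_cancel_of_denseRange hd ?_
    rw [mul_assoc, hU, hXC]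
  have cA : A * U = U * A := by
    refine mul_right_cancel_of_denseRange hd ?_
    have h1 : (q : ℂ) • (A * (U * X)) = (q : ℂ) • (U * (A * X)) := by
      rw [hU, ← h.comm, ← mul_smul_comm, ← hXA, ← mul_assoc, hU]
    have h2 := smul_right_injective _ hq0 h1
    simpa only [mul_assoc] using h2
  have cA' : star A * U = U * star A := by
    refine mul_right_cancel_of_denseRange hd ?_
    rw [mul_assoc, hU, h.star_comm, mul_assoc, hAX, mul_smul_comm, ← mul_assoc U, hU]
  have hUs : X * star U = star C := by
    rw [← hU, star_mul, hXs]
  have cX' : X * star U = star U * X := by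
    have := congrArg star cX
    simpa [hXs] using this.symm
  -- Normality of `C` enters here; it makes the isometry `U` unitary in `hUU'`.
  have cC' : star C * U = U * star C := by
    refine mul_right_cancel_of_denseRange hd ?_
    rw [mul_assoc, hU, mul_assoc, hXC', ← mul_assoc, hU, h.normal]
  have hUU' : U * star U = 1 := by
    refine mul_right_cancel_of_denseRange hd ?_
    rw [mul_assoc, ← cX', hUs, ← cC', ← hUs, mul_assoc, hUU, mul_one, one_mul]
  -- The fibres over `U`: replacing `C = U X` by `u X` leaves `C C*` unchanged.
  have hpair : ∀ u : Circle, IsQuantumPair q A ((u : ℂ) • X) := by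
    intro u
    have hu : (u : ℂ) * conj (u : ℂ) = 1 := by
      rw [Complex.mul_conj, Complex.normSq_eq_norm_sq, Circle.norm_coe]; simp
    have k : star ((u : ℂ) • X) = conj (u : ℂ) • X := by rw [star_smul, hXs]; rfl
    have k2 : (u : ℂ) • X * star ((u : ℂ) • X) = C * star C := by
      rw [k, smul_mul_smul_comm, hu, one_smul, hXX, h.normal]
    refine ⟨?_, ?_, ?_, ?_, ?_⟩
    · rw [smul_mul_assoc, hXA, mul_smul_comm, smul_comm]
    · rw [smul_mul_assoc, mul_smul_comm, hAX, smul_comm]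
    · rw [k, smul_mul_smul_comm, smul_mul_smul_comm, mul_comm]
    · rw [k2, h.mul_star]
    · rw [k2, h.star_mul]
  have hf : IsFiberedOver U (pairRep hq h hg a) fun u => pairRep hq (hpair u) hg a := by
    have sU := IsFiberedOver.self U
    have sU' := IsFiberedOver.star_self hUU hUU'
    have sX : IsFiberedOver U X (fun _ => X) := IsFiberedOver.const cX
    have sA : IsFiberedOver U A (fun _ => A) := IsFiberedOver.const cA
    have sA' : IsFiberedOver U (star A) (fun _ => star A) := IsFiberedOver.const cA'
    have sC : IsFiberedOver U C (fun u => (u : ℂ) • X) :=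
      (sU.mul sX).congr hU fun u => by rw [smul_mul_assoc, one_mul]
    have sC' : IsFiberedOver U (star C) (fun u => conj (u : ℂ) • X) :=
      (sU'.mul sX).congr (cX'.symm.trans hUs) fun u => by rw [smul_mul_assoc, one_mul]
    refine PolMat2.isFiberedOver (fun a α => ?_) (fun a α => ?_) a <;>
      simp only [pairRep_z] <;> fin_cases a <;> fin_cases α
    · exact sA'.smul (-((q : ℂ)⁻¹ * g))
    · exact sC
    · exact (sC'.smul g).congr rfl fun u => by simp [pairGen, star_smul, hXs]
    · exact sA
    · exact (sA.smul (conj (-((q : ℂ)⁻¹ * g)))).congr (by simp [pairGen, star_smul])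
        fun u => by simp [pairGen, star_smul]
    · exact sC'.congr rfl fun u => by simp [pairGen, star_smul, hXs]
    · exact (sC.smul (conj g)).congr (by simp [pairGen, star_smul])
        fun u => by simp [pairGen, star_smul, hXs]
    · exact sA'
  refine hf.opNorm_le (norm_apply_of_star_mul_self hUU) fun u => ?_
  obtain ⟨φ₁, φ₂, hρ⟩ := pairRep_shift_eq_rho hq (Circle.norm_coe u) hg
  refine le_trans ?_ (hM φ₁ φ₂)
  rw [← hρ]
  -- The fibre is a sum of copies of a single `rho`, so its norm is at most that of `rho`.
  refine IsHilbertSum.opNorm_le hW fun i x => ?_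
  refine pairRep_intertwines hq _ (hpair u) hg (W i).toContinuousLinearMap (hWA i) (hWA' i)
    (fun x => ?_) (fun x => ?_) a x
  · change W i ((u : ℂ) • d hq x) = (u : ℂ) • X (W i x)
    rw [map_smul, hWX]
  · rw [star_smul, star_smul, hXs, star_d]
    change W i (conj (u : ℂ) • d hq x) = conj (u : ℂ) • X (W i x)
    rw [map_smul, hWX]

/-- The norm estimate for the representations determined by a quantum pair. -/
theorem norm_pairRep_le {A C : H →L[ℂ] H} (h : IsQuantumPair q A C) {g : ℂ} (hg : ‖g‖ = 1)
    {a : PolMat2 q} {M : ℝ} (hM : ∀ φ₁ φ₂ : ℝ, ‖rho hq φ₁ φ₂ a‖ ≤ M) :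
    ‖pairRep hq h hg a‖ ≤ M := by
  have hM0 : 0 ≤ M := (norm_nonneg _).trans (hM 0 0)
  have hq0 : (q : ℂ) ≠ 0 := by exact_mod_cast hq.1.ne'
  have app : ∀ {T T' : H →L[ℂ] H}, T = T' → ∀ x, T x = T' x := fun h x => by rw [h]
  -- `K` and its complement are invariant under `A`, `C` and their adjoints: the pair vanishes in
  -- its second entry on `K` and is injective there on the complement. The two estimates combine by
  -- Pythagoras.
  let K : Submodule ℂ H := C.ker
  have hK : ∀ {x}, x ∈ K ↔ C x = 0 := Iff.rfl
  have : CompleteSpace K := C.isClosed_ker.completeSpace_coe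
  have kA : ∀ x ∈ K, A x ∈ K := fun x hx => by
    have := app h.comm x
    simpa [hK, hK.1 hx] using this
  have kA' : ∀ x ∈ K, star A x ∈ K := fun x hx => by
    have := app h.star_comm x
    rw [mul_apply_eq_comp, hK.1 hx, map_zero, _root_.smul_apply, mul_apply_eq_comp] at this
    exact (smul_eq_zero.1 this.symm).resolve_left hq0
  have kC : ∀ x ∈ K, C x ∈ K := fun x hx => by
    rw [hK.1 hx]; exact K.zero_mem
  have kC' : ∀ x ∈ K, star C x ∈ K := fun x hx => by
    have := app h.normal x
    rw [mul_apply_eq_comp, hK.1 hx, map_zero, mul_apply_eq_comp] at this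
    exact this.symm
  have oA := orthogonal_invariant (T := A) kA'
  have oA' := orthogonal_invariant (T := star A) (by simpa using kA)
  have oC := orthogonal_invariant (T := C) kC'
  have oC' := orthogonal_invariant (T := star C) (by simpa using kC)
  have b₀ : ∀ x ∈ K, pairRep hq h hg a x ∈ K ∧ ‖pairRep hq h hg a x‖ ≤ M * ‖x‖ := by
    intro x hx
    have h0 := h.restrictTo K kA kA' kC kC'
    have hz : restrictTo K C kC = 0 := by
      ext y; exact y.2
    have hs : star C x = 0 := by
      rw [← norm_eq_zero, h.norm_star_apply, hK.1 hx, norm_zero]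
    have h0' : IsQuantumPair q (restrictTo K A kA) 0 := hz ▸ h0
    have hi := pairRep_intertwines hq h0' h hg K.subtypeL (fun _ => rfl)
      (fun y => by rw [star_restrictTo K A kA kA']; rfl) (fun y => (hK.1 y.2).symm)
      (fun y => by
        rw [star_zero]
        have : star C (y : H) = 0 := by
          rw [← norm_eq_zero, h.norm_star_apply, hK.1 y.2, norm_zero]
        exact this.symm) a ⟨x, hx⟩
    change ((pairRep hq h0' hg a ⟨x, hx⟩ : K) : H) = pairRep hq h hg a x at hi
    rw [← hi]
    refine ⟨Subtype.coe_prop _, ?_⟩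
    exact ((pairRep hq h0' hg a).le_opNorm ⟨x, hx⟩).trans
      (mul_le_mul_of_nonneg_right (norm_pairRep_le_of_zero hq h0' hg hM) (norm_nonneg _))
  have b₁ : ∀ x ∈ Kᗮ, pairRep hq h hg a x ∈ Kᗮ ∧ ‖pairRep hq h hg a x‖ ≤ M * ‖x‖ := by
    intro x hx
    have h1 := h.restrictTo Kᗮ oA oA' oC oC'
    have hi := pairRep_intertwines hq h1 h hg Kᗮ.subtypeL (fun _ => rfl)
      (fun y => by rw [star_restrictTo Kᗮ A oA oA']; rfl) (fun _ => rfl)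
      (fun y => by rw [star_restrictTo Kᗮ C oC oC']; rfl) a ⟨x, hx⟩
    change ((pairRep hq h1 hg a ⟨x, hx⟩ : Kᗮ) : H) = pairRep hq h hg a x at hi
    rw [← hi]
    refine ⟨Subtype.coe_prop _, ?_⟩
    refine ((pairRep hq h1 hg a).le_opNorm ⟨x, hx⟩).trans
      (mul_le_mul_of_nonneg_right (norm_pairRep_le_of_injective hq h1 ?_ hg hM) (norm_nonneg _))
    intro y hy
    have hy' : C (y : H) = 0 := congrArg Subtype.val hy
    have : inner ℂ (y : H) (y : H) = 0 := y.2 y (hK.2 hy')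
    exact Subtype.ext (inner_self_eq_zero.1 this)
  refine ContinuousLinearMap.opNorm_le_bound _ hM0 fun x => ?_
  obtain ⟨y, hy, z, hz, rfl⟩ := K.exists_add_mem_mem_orthogonal x
  obtain ⟨y1, y2⟩ := b₀ y hy
  obtain ⟨z1, z2⟩ := b₁ z hz
  have p1 := norm_add_sq_eq_norm_sq_add_norm_sq_of_inner_eq_zero y z (hz y hy)
  have p2 := norm_add_sq_eq_norm_sq_add_norm_sq_of_inner_eq_zero (pairRep hq h hg a y)
    (pairRep hq h hg a z) (z1 _ y1)
  rw [map_add]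
  refine le_of_sq_le_sq ?_ (by positivity)
  have y3 := pow_le_pow_left₀ (norm_nonneg _) y2 2
  have z3 := pow_le_pow_left₀ (norm_nonneg _) z2 2
  rw [pow_two, p2, mul_pow, pow_two ‖y + z‖, p1]
  nlinarith

/-- The norm estimate for the representations that annihilate the Shilov boundary ideal. -/
theorem norm_le_of_shilovIdeal (π : PolMat2 q →⋆ₐ[ℂ] (H →L[ℂ] H))
    (hπ : ∀ x ∈ PolMat2.shilovIdeal q, π x = 0) {a : PolMat2 q} {M : ℝ}
    (hM : ∀ φ₁ φ₂ : ℝ, ‖rho hq φ₁ φ₂ a‖ ≤ M) : ‖π a‖ ≤ M := by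
  have hq0 : (q : ℂ) ≠ 0 := by exact_mod_cast hq.1.ne'
  have hz : ∀ a b, MatRel q (fun i j => π (PolMat2.z q i j))
      (fun i j => star (π (PolMat2.z q i j))) a b → a = b := by
    intro a b hab
    simp only [← map_star] at hab
    cases hab <;>
      simp only [← map_mul, ← map_add, ← map_sub, ← map_smul, ← map_one π] <;>
      exact congrArg π (PolMat2.rel q (by constructor))
  have J : ∀ α β : Fin 2, (∑ j : Fin 2, ((q : ℂ) ^ (4 - (α.val + 1) - (β.val + 1))) •
      (π (PolMat2.z q j α) * star (π (PolMat2.z q j β)))) - (if α = β then 1 else 0) = 0 := by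
    intro α β
    have := hπ _ (TwoSidedIdeal.subset_span ⟨α, β, rfl⟩)
    rw [map_sub, map_sum] at this
    simp only [map_smul, map_mul, map_star] at this
    split_ifs at this ⊢ <;> simpa using this
  have J1 := J 0 0
  have J2 := J 1 1
  -- The remaining pair of indices would give the adjoint of this relation.
  have J3 := J 0 1
  simp only [Fin.sum_univ_two, Fin.val_zero, Fin.val_one, if_true, zero_ne_one, if_false,
    sub_zero, zero_add, Nat.reduceAdd, Nat.reduceSub, pow_zero, one_smul, pow_one,
    sub_eq_zero, ← smul_add] at J1 J2 J3
  obtain ⟨h, G, g1, g2, gA, gA', gC, gC', hB, hD⟩ := exists_unitary_of_shilov hq hz J1 J2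
    ((smul_eq_zero.1 J3).resolve_left hq0)
  generalize hA : π (PolMat2.z q 1 1) = A at *
  generalize hC : π (PolMat2.z q 0 1) = C at *
  have eC : C * star G = star G * C := by simpa using congrArg star gC'.eq
  have eA : A * star G = star G * A := by simpa using congrArg star gA'.eq
  have hB' : star (π (PolMat2.z q 1 0)) = star G * C := by
    rw [hB, star_mul, star_star, ← eC]
  have hD' : star (π (PolMat2.z q 0 0)) = -(q : ℂ)⁻¹ • (star G * A) := by
    rw [hD, star_smul, star_mul, star_star, ← eA]
    simp
  -- The unitary `G` is replaced by the scalar parameter of a pair representation with the same `A`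
  -- and `C`.
  have hf : IsFiberedOver G (π a) fun u => pairRep hq h (Circle.norm_coe u) a := by
    have sG := IsFiberedOver.self G
    have sG' := IsFiberedOver.star_self g1 g2
    have sA : IsFiberedOver G A (fun _ => A) := IsFiberedOver.const gA.symm
    have sA' : IsFiberedOver G (star A) (fun _ => star A) := IsFiberedOver.const gA'.symm
    have sC : IsFiberedOver G C (fun _ => C) := IsFiberedOver.const gC.symm
    have sC' : IsFiberedOver G (star C) (fun _ => star C) := IsFiberedOver.const gC'.symm
    refine PolMat2.isFiberedOver (fun a α => ?_) (fun a α => ?_) a <;>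
      simp only [pairRep_z] <;> fin_cases a <;> fin_cases α
    · exact ((sG.mul sA').smul (-(q : ℂ)⁻¹)).congr hD.symm fun u => by
        simp [pairGen, smul_smul]
    · exact sC.congr hC.symm fun u => rfl
    · exact (sG.mul sC').congr hB.symm fun u => by simp [pairGen]
    · exact sA.congr hA.symm fun u => rfl
    · exact ((sG'.mul sA).smul (-(q : ℂ)⁻¹)).congr hD'.symm fun u => by
        simp [pairGen, smul_smul, star_smul]
    · exact sC'.congr (congrArg star hC.symm) fun u => rfl
    · exact (sG'.mul sC).congr hB'.symm fun u => by simp [pairGen, star_smul]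
    · exact sA'.congr (congrArg star hA.symm) fun u => rfl
  exact hf.opNorm_le (norm_apply_of_star_mul_self g1) fun u => norm_pairRep_le hq h _ hM

end NormBound

end QuantumBall

theorem mainTheorem5 {q : ℝ} (hq : q ∈ Set.Ioo (0 : ℝ) 1) :
    -- the norm inequality for every representation that annihilates the ideal
    (∀ {H : Type*} [NormedAddCommGroup H] [InnerProductSpace ℂ H] [CompleteSpace H]
      (π : QuantumBall.PolMat2 q →⋆ₐ[ℂ] (H →L[ℂ] H)),
      (∀ x ∈ QuantumBall.PolMat2.shilovIdeal q, π x = 0) →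
      ∀ a : QuantumBall.PolMat2 q,
        BddAbove (Set.range fun ψ : Set.Ico (0 : ℝ) (2 * Real.pi) × Set.Ico (0 : ℝ) (2 * Real.pi) =>
          ‖QuantumBall.rho hq ψ.1 ψ.2 a‖) ∧
        ‖π a‖ ≤ ⨆ ψ : Set.Ico (0 : ℝ) (2 * Real.pi) × Set.Ico (0 : ℝ) (2 * Real.pi),
          ‖QuantumBall.rho hq ψ.1 ψ.2 a‖) ∧
    -- the factorization of the one-dimensional representations through the Toeplitz algebra
    (∀ φ₁ φ₂ : ℝ, ∃ Θ : QuantumBall.toeplitz →⋆ₐ[ℂ] ℂ,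
      Θ ⟨QuantumBall.S, QuantumBall.S_mem_toeplitz⟩ = Complex.exp (φ₁ * Complex.I) ∧
      ∀ a : QuantumBall.PolMat2 q,
        ∃ h : QuantumBall.rho hq φ₁ (Real.pi + φ₂) a ∈ QuantumBall.toeplitz,
          Θ ⟨QuantumBall.rho hq φ₁ (Real.pi + φ₂) a, h⟩ = QuantumBall.gamma hq φ₁ φ₂ a) := by
  refine ⟨fun {H} _ _ _ π hπ a => ?_, fun φ₁ φ₂ => ?_⟩
  · have hb : BddAbove (Set.range
        fun ψ : Set.Ico (0 : ℝ) (2 * Real.pi) × Set.Ico (0 : ℝ) (2 * Real.pi) =>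
          ‖QuantumBall.rho hq ψ.1 ψ.2 a‖) := by
      obtain ⟨M, hM⟩ := QuantumBall.exists_norm_rho_le hq a
      exact ⟨M, by rintro _ ⟨ψ, rfl⟩; exact hM _ _⟩
    refine ⟨hb, QuantumBall.norm_le_of_shilovIdeal hq π hπ fun φ₁ φ₂ => ?_⟩
    -- The estimate asks for a bound at all real angles, the supremum runs over one period; `rho`
    -- depends on the angles only through `expI`.
    obtain ⟨ψ₁, m₁, e₁⟩ := QuantumBall.exists_expI_eq_mem_Ico φ₁
    obtain ⟨ψ₂, m₂, e₂⟩ := QuantumBall.exists_expI_eq_mem_Ico φ₂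
    rw [← QuantumBall.rho_congr hq e₁ e₂]
    exact le_ciSup hb (⟨ψ₁, m₁⟩, ⟨ψ₂, m₂⟩)
  · obtain ⟨Θ, -, h₁, h₂⟩ := QuantumBall.exists_toeplitz_character hq φ₁ φ₂
    exact ⟨Θ, h₁, h₂⟩
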